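/- Let $\mathbb{k}$ be an algebraically closed field of characteristic $0$ and let $q\in\mathbb{k}$ be a root of unity of multiplicative order $d\ge 2$. Let $\mathcal{A}$ be the infinite linear quiver, with vertex set $\mathbb{Z}$ and one arrow $i\to i+1$ for each $i\in\mathbb{Z}$, and let $p_i^l$ denote the path of length $l\ge 0$ starting at $i$. Let $\mathbb{k}\mathcal{A}(q)$ be the path coalgebra of $\mathcal{A}$, with $\Delta(p_i^l)=\sum_{c=0}^{l}p_{i+c}^{l-c}\otimes p_i^c$ and $\varepsilon(p_i^l)=\delta_{l,0}$, made into a Hopf algebra by $p_i^l\cdot p_j^m=q^{im}\binom{l+m}{l}_q p_{i+j}^{l+m}$, where $\binom{l+m}{l}_q$ is the Gaussian binomial coefficient. Let $\mathcal{D}_q$ be the tensor category of finite dimensional right $\mathbb{k}\mathcal{A}(q)$-comodules; thus the comodule structure on $U\otimes V$ is $u\otimes v\mapsto u_0\otimes v_0\otimes u_1v_1$. For $i\in\mathbb{Z}$ and $l\ge 0$ let $V(i,l)\in\mathcal{D}_q$ be the comodule with basis $v_0,\dots,v_l$ and structure map $\delta(v_m)=\sum_{j=m}^{l}v_j\otimes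 p_{i+m}^{j-m}$. Equality below means isomorphism in $\mathcal{D}_q$, and a direct sum over an empty range is $0$. Let $e,m\ge 0$ and $0\le f,h\le d-1$ be integers with $ed+f\le md+h$, and put $\gamma=f+h-d+1$. Then $$V(0,ed+f)\otimes V(0,md+h)=V(0,md+h)\otimes V(0,ed+f),$$ and this comodule decomposes as follows. (1) If $f\le h$ and $f+h<d-1$, then $$\begin{aligned}V(0,ed+f)\otimes V(0,md+h)=&\bigoplus_{k=0}^{e-1}\Big[\bigoplus_{i=0}^{f}V(kd+i,(e+m-2k)d+f+h-2i)\oplus\bigoplus_{j=f+1}^{h}V(kd+j,(e+m-2k)d-1)\\&\oplus\bigoplus_{r=h+1}^{f+h+1}V(kd+r,(e+m-2k)d+f+h-2r)\oplus\bigoplus_{s=f+h+2}^{d-1}V(kd+s,(e+m-1-2k)d-1)\Big]\\&\oplus\bigoplus_{i=0}^{f}V(ed+i,(m-e)d+f+h-2i).\end{aligned}$$ (2) If $f\le h$ and $f+h\ge d-1$, then $$\begin{aligned}V(0,ed+f)\otimes V(0,md+h)=&\bigoplus_{k=0}^{e-1}\Big[\bigoplus_{i=0}^{\gamma}V(kd+i,(e+m-2k)d+d-1)\oplus\bigoplus_{j=\gamma+1}^{f}V(kd+j,(e+m-2k)d+f+h-2j)\\&\oplus\bigoplus_{r=f+1}^{h}V(kd+r,(e+m-2k)d-1)\oplus\bigoplus_{s=h+1}^{d-1}V(kd+s,(e+m-2k)d+f+h-2s)\Big]\\&\oplus\bigoplus_{i=0}^{\gamma}V(ed+i,(m-e)d+d-1)\oplus\bigoplus_{i=\gamma+1}^{f}V(ed+i,(m-e)d+f+h-2i).\end{aligned}$$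 (3) If $h<f$ and $f+h<d-1$, then $$\begin{aligned}V(0,ed+f)\otimes V(0,md+h)=&\bigoplus_{k=0}^{e-1}\Big[\bigoplus_{i=0}^{h}V(kd+i,(e+m-2k)d+f+h-2i)\oplus\bigoplus_{j=h+1}^{f}V(kd+j,(e+m-2k)d-1)\\&\oplus\bigoplus_{r=f+1}^{f+h+1}V(kd+r,(e+m-2k)d+f+h-2r)\oplus\bigoplus_{s=f+h+2}^{d-1}V(kd+s,(e+m-1-2k)d-1)\Big]\\&\oplus\bigoplus_{i=0}^{h}V(ed+i,(m-e)d+f+h-2i)\oplus\bigoplus_{i=h+1}^{f}V(ed+i,(m-e)d-1).\end{aligned}$$ (4) If $h<f$ and $f+h\ge d-1$, then $$\begin{aligned}V(0,ed+f)\otimes V(0,md+h)=&\bigoplus_{k=0}^{e-1}\Big[\bigoplus_{i=0}^{\gamma}V(kd+i,(e+m-2k)d+d-1)\oplus\bigoplus_{j=\gamma+1}^{h}V(kd+j,(e+m-2k)d+f+h-2j)\\&\oplus\bigoplus_{r=h+1}^{f}V(kd+r,(e+m-2k)d-1)\oplus\bigoplus_{s=f+1}^{d-1}V(kd+s,(e+m-2k)d+f+h-2s)\Big]\\&\oplus\bigoplus_{i=0}^{\gamma}V(ed+i,(m-e)d+d-1)\oplus\bigoplus_{i=\gamma+1}^{h}V(ed+i,(m-e)d+f+h-2i)\oplus\bigoplus_{i=h+1}^{f}V(ed+i,(m-e)d-1).\end{aligned}$$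 -/

import Mathlib

open scoped TensorProduct

universe u v

noncomputable section

/-! ### Gaussian binomial coefficients -/

/-- The `q`-integer `1 + q + ⋯ + q^(n-1)`. -/
def qInt {R : Type u} [CommRing R] (q : R) (n : ℕ) : R := ∑ i ∈ Finset.range n, q ^ i

/-- The `q`-factorial. -/
def qFactorial {R : Type u} [CommRing R] (q : R) (n : ℕ) : R :=
  ∏ i ∈ Finset.range n, qInt q (i + 1)

/-- The Gaussian binomial coefficient. It is defined by the `q`-Pascal recursion, so that it makes
sense at roots of unity, where the quotient of `q`-factorials is `0 / 0`; the quotient formula is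
`gaussBinom_mul_qFactorial`. -/
def gaussBinom {R : Type u} [CommRing R] (q : R) : ℕ → ℕ → R
  | _, 0 => 1
  | 0, _ + 1 => 0
  | n + 1, j + 1 => gaussBinom q n j + q ^ (j + 1) * gaussBinom q n (j + 1)

section gauss

variable {R : Type u} [CommRing R] (q : R)

@[simp] theorem gaussBinom_zero_right (n : ℕ) : gaussBinom q n 0 = 1 := by
  cases n <;> rfl

theorem gaussBinom_succ_succ (n j : ℕ) : gaussBinom q (n + 1) (j + 1) =
    gaussBinom q n j + q ^ (j + 1) * gaussBinom q n (j + 1) := rfl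

theorem gaussBinom_eq_zero (n j : ℕ) (h : n < j) : gaussBinom q n j = 0 := by
  induction n generalizing j with
  | zero => obtain ⟨j, rfl⟩ := Nat.exists_eq_succ_of_ne_zero (by omega : j ≠ 0); rfl
  | succ n ih =>
    obtain ⟨j, rfl⟩ := Nat.exists_eq_succ_of_ne_zero (by omega : j ≠ 0)
    rw [Nat.succ_eq_add_one, gaussBinom_succ_succ, ih _ (by omega), ih _ (by omega)]; simp

@[simp] theorem gaussBinom_self (n : ℕ) : gaussBinom q n n = 1 := by
  induction n with
  | zero => rfl
  | succ n ih => rw [gaussBinom_succ_succ, ih, gaussBinom_eq_zero _ _ _ (Nat.lt_succ_self n)]; simp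

theorem qInt_add (m n : ℕ) : qInt q (m + n) = qInt q m + q ^ m * qInt q n := by
  simp [qInt, Finset.sum_range_add, Finset.mul_sum, pow_add]

theorem qFactorial_succ (n : ℕ) : qFactorial q (n + 1) = qFactorial q n * qInt q (n + 1) := by
  simp [qFactorial, Finset.prod_range_succ]

/-- The Gaussian binomial coefficient is the quotient of `q`-factorials. -/
theorem gaussBinom_mul_qFactorial (l m : ℕ) :
    gaussBinom q (l + m) l * (qFactorial q l * qFactorial q m) = qFactorial q (l + m) := by
  induction l generalizing m with
  | zero => simp [qFactorial]
  | succ l ih =>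
    induction m with
    | zero => simp [qFactorial]
    | succ m ihm =>
      have h1 := ih (m + 1)
      have h2 : qInt q (l + 1 + (m + 1)) = qInt q (l + 1) + q ^ (l + 1) * qInt q (m + 1) :=
        qInt_add q _ _
      have e1 : l + 1 + (m + 1) = (l + (m + 1)) + 1 := by omega
      have e2 : l + 1 + m = l + (m + 1) := by omega
      rw [e2] at ihm
      rw [e1] at h2 ⊢
      rw [gaussBinom_succ_succ, qFactorial_succ q (l + (m + 1)), h2]
      rw [qFactorial_succ q m] at h1 ⊢
      rw [qFactorial_succ q l] at ihm ⊢
      linear_combination qInt q (l + 1) * h1 + q ^ (l + 1) * qInt q (m + 1) * ihm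

theorem map_gaussBinom {S : Type v} [CommRing S] (φ : R →+* S) (n j : ℕ) :
    φ (gaussBinom q n j) = gaussBinom (φ q) n j := by
  induction n generalizing j with
  | zero => cases j <;> simp [gaussBinom]
  | succ n ih => cases j <;> simp [gaussBinom, ih]

theorem qFactorial_X_ne_zero (n : ℕ) :
    qFactorial (Polynomial.X : Polynomial ℤ) n ≠ 0 := by
  rw [qFactorial, Finset.prod_ne_zero_iff]
  intro i _ h
  have := congrArg (Polynomial.eval 1) h
  simp [qInt, Polynomial.eval_finsetSum] at this
  omega

theorem gaussBinom_symm (l m : ℕ) : gaussBinom q (l + m) l = gaussBinom q (l + m) m := by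
  have key : gaussBinom (Polynomial.X : Polynomial ℤ) (l + m) l = gaussBinom Polynomial.X (l + m) m := by
    have h1 := gaussBinom_mul_qFactorial (Polynomial.X : Polynomial ℤ) l m
    have h2 := gaussBinom_mul_qFactorial (Polynomial.X : Polynomial ℤ) m l
    rw [add_comm m l] at h2
    apply mul_right_cancel₀
      (mul_ne_zero (qFactorial_X_ne_zero l) (qFactorial_X_ne_zero m))
    rw [h1, mul_comm (qFactorial _ l), h2]
  simpa [map_gaussBinom] using congrArg (Polynomial.eval₂RingHom (Int.castRingHom R) q) key

theorem gaussBinom_trinomial (l m r : ℕ) :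
    gaussBinom q (l + m) l * gaussBinom q (l + m + r) (l + m) =
      gaussBinom q (m + r) m * gaussBinom q (l + (m + r)) l := by
  have key : gaussBinom (Polynomial.X : Polynomial ℤ) (l + m) l *
      gaussBinom Polynomial.X (l + m + r) (l + m) =
      gaussBinom Polynomial.X (m + r) m * gaussBinom Polynomial.X (l + (m + r)) l := by
    set x := (Polynomial.X : Polynomial ℤ)
    have h1 := gaussBinom_mul_qFactorial x l m
    have h2 := gaussBinom_mul_qFactorial x (l + m) r
    have h3 := gaussBinom_mul_qFactorial x m r
    have h4 := gaussBinom_mul_qFactorial x l (m + r)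
    rw [← h1, add_assoc] at h2
    rw [← h3] at h4
    rw [add_assoc l m r]
    apply mul_right_cancel₀ (mul_ne_zero (mul_ne_zero (qFactorial_X_ne_zero l)
      (qFactorial_X_ne_zero m)) (qFactorial_X_ne_zero r))
    linear_combination h2 - h4
  have key' := congrArg (Polynomial.eval₂RingHom (Int.castRingHom R) q) key
  rw [map_mul, map_mul] at key'
  simpa only [map_gaussBinom, Polynomial.coe_eval₂RingHom, Polynomial.eval₂_X] using key'

theorem gaussBinom_pascal (a b : ℕ) : gaussBinom q (a + 1 + (b + 1)) (a + 1) =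
    q ^ (b + 1) * gaussBinom q (a + (b + 1)) a + gaussBinom q (a + 1 + b) (a + 1) := by
  rw [gaussBinom_symm, gaussBinom_symm q a, gaussBinom_symm q (a + 1) b]
  rw [show a + 1 + (b + 1) = (a + 1 + b) + 1 by omega, gaussBinom_succ_succ,
    show a + (b + 1) = a + 1 + b by omega]
  ring

/-- The `q`-Vandermonde identity, with values in a module. -/
theorem gaussBinom_vandermonde {M : Type v} [AddCommGroup M] [Module R M]
    (l m : ℕ) (F : ℕ → ℕ → M) :
    ∑ x ∈ Finset.HasAntidiagonal.antidiagonal l, ∑ y ∈ Finset.HasAntidiagonal.antidiagonal m,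
      (q ^ (x.1 * y.2) * gaussBinom q (x.2 + y.2) x.2 * gaussBinom q (x.1 + y.1) x.1) •
        F (x.1 + y.1) (x.2 + y.2) =
    gaussBinom q (l + m) l • ∑ z ∈ Finset.HasAntidiagonal.antidiagonal (l + m), F z.1 z.2 := by
  induction l generalizing m F with
  | zero => simp
  | succ l ih1 =>
    induction m generalizing F with
    | zero => simp
    | succ m ih2 =>
      have h1 := ih1 (m + 1) (fun a b => F (a + 1) b)
      have h2 := ih2 (fun a b => F (a + 1) b)
      have e : l + 1 + (m + 1) = (l + (m + 1)) + 1 := by omega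
      have hp := gaussBinom_pascal q l m
      rw [e, show l + 1 + m = l + (m + 1) by omega] at hp
      rw [e, Finset.Nat.sum_antidiagonal_succ (n := l + (m + 1)), smul_add]
      rw [hp, add_smul _ _ (Finset.sum _ _), mul_smul, ← h1]
      rw [show l + 1 + m = l + (m + 1) by omega] at h2
      rw [← h2, ← hp]
      rw [Finset.Nat.sum_antidiagonal_succ (n := l), Finset.Nat.sum_antidiagonal_succ (n := l)]
      simp only [Finset.Nat.sum_antidiagonal_succ (n := m)]
      simp only [Finset.sum_add_distrib, smul_add, Finset.smul_sum]
      have t1 : ∀ x : ℕ × ℕ,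
          (q ^ ((x.1 + 1) * (m + 1)) * gaussBinom q (x.2 + (m + 1)) x.2 *
            gaussBinom q (x.1 + 1 + 0) (x.1 + 1)) • F (x.1 + 1 + 0) (x.2 + (m + 1)) =
          q ^ (m + 1) • (q ^ (x.1 * (m + 1)) * gaussBinom q (x.2 + (m + 1)) x.2 *
            gaussBinom q (x.1 + 0) x.1) • F (x.1 + 0 + 1) (x.2 + (m + 1)) := by
        intro x
        simp only [add_zero, gaussBinom_self, smul_smul]
        ring_nf
      have t2 : ∑ x ∈ Finset.HasAntidiagonal.antidiagonal l,
          ∑ y ∈ Finset.HasAntidiagonal.antidiagonal m,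
          (q ^ ((x.1 + 1) * y.2) * gaussBinom q (x.2 + y.2) x.2 *
            gaussBinom q (x.1 + 1 + (y.1 + 1)) (x.1 + 1)) •
            F (x.1 + 1 + (y.1 + 1)) (x.2 + y.2) =
          ∑ x ∈ Finset.HasAntidiagonal.antidiagonal l,
          ∑ y ∈ Finset.HasAntidiagonal.antidiagonal m,
          q ^ (m + 1) • (q ^ (x.1 * y.2) * gaussBinom q (x.2 + y.2) x.2 *
            gaussBinom q (x.1 + (y.1 + 1)) x.1) • F (x.1 + (y.1 + 1) + 1) (x.2 + y.2) +
          ∑ x ∈ Finset.HasAntidiagonal.antidiagonal l,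
          ∑ y ∈ Finset.HasAntidiagonal.antidiagonal m,
          (q ^ ((x.1 + 1) * y.2) * gaussBinom q (x.2 + y.2) x.2 *
            gaussBinom q (x.1 + 1 + y.1) (x.1 + 1)) • F (x.1 + 1 + y.1 + 1) (x.2 + y.2) := by
        rw [← Finset.sum_add_distrib]
        refine Finset.sum_congr rfl fun x _ => ?_
        rw [← Finset.sum_add_distrib]
        refine Finset.sum_congr rfl fun y hy => ?_
        obtain rfl := Finset.HasAntidiagonal.mem_antidiagonal.mp hy
        rw [gaussBinom_pascal, smul_smul,
          show x.1 + (y.1 + 1) + 1 = x.1 + 1 + (y.1 + 1) by omega,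
          show x.1 + 1 + y.1 + 1 = x.1 + 1 + (y.1 + 1) by omega, ← add_smul]
        congr 1
        ring
      rw [t2]
      simp only [t1]
      simp only [zero_add, add_zero, zero_mul, pow_zero, one_mul, gaussBinom_zero_right, mul_one, e]
      abel

end gauss

/-! ### The bialgebra of the infinite linear quiver -/

/-- The path space of the infinite linear quiver, whose vertices are the integers, with one arrow
`i ⟶ i + 1` for each `i`. The basis vector with index `(i, l)` is the path of length `l` starting
at the vertex `i`. The parameter `q` enters only in the multiplication. -/
@[nolint unusedArguments]
def LinPath {k : Type u} [Field k] (_q : kˣ) : Type u := (ℤ × ℕ) →₀ k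

namespace LinPath

open Finset.HasAntidiagonal

variable {k : Type u} [Field k] (q : kˣ)

instance : AddCommGroup (LinPath q) := inferInstanceAs (AddCommGroup ((ℤ × ℕ) →₀ k))

instance : Module k (LinPath q) := inferInstanceAs (Module k ((ℤ × ℕ) →₀ k))

/-- The basis of paths. -/
def basis : Module.Basis (ℤ × ℕ) k (LinPath q) := Finsupp.basisSingleOne

/-- The path of length `l` starting at the vertex `i`. -/
def path (i : ℤ) (l : ℕ) : LinPath q := basis q (i, l)

theorem basis_apply (x : ℤ × ℕ) : basis q x = path q x.1 x.2 := rfl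

/-- The comultiplication splits paths; the initial part of the path is the right tensor factor. -/
def comulMap : LinPath q →ₗ[k] LinPath q ⊗[k] LinPath q :=
  (basis q).constr k fun p =>
    ∑ x ∈ antidiagonal p.2, path q (p.1 + x.1) x.2 ⊗ₜ[k] path q p.1 x.1

/-- The counit is `1` on the vertices and `0` on the paths of positive length. -/
def counitMap : LinPath q →ₗ[k] k :=
  (basis q).constr k fun p => if p.2 = 0 then 1 else 0

/-- The multiplication of paths, as a bilinear map. -/
def mulMap : LinPath q →ₗ[k] LinPath q →ₗ[k] LinPath q :=
  (basis q).constr k fun x => (basis q).constr k fun y =>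
    (((q ^ (x.1 * (y.2 : ℤ)) : kˣ) : k) * gaussBinom (q : k) (x.2 + y.2) x.2) •
      path q (x.1 + y.1) (x.2 + y.2)

theorem comulMap_path (i : ℤ) (l : ℕ) : comulMap q (path q i l) =
    ∑ x ∈ antidiagonal l, path q (i + x.1) x.2 ⊗ₜ[k] path q i x.1 :=
  (basis q).constr_basis k _ (i, l)

theorem counitMap_path (i : ℤ) (l : ℕ) : counitMap q (path q i l) = if l = 0 then 1 else 0 :=
  (basis q).constr_basis k _ (i, l)

theorem mulMap_path (i j : ℤ) (l m : ℕ) : mulMap q (path q i l) (path q j m) =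
    (((q ^ (i * (m : ℤ)) : kˣ) : k) * gaussBinom (q : k) (l + m) l) • path q (i + j) (l + m) := by
  have h := (basis q).constr_basis k (fun x => (basis q).constr k fun y =>
    (((q ^ (x.1 * (y.2 : ℤ)) : kˣ) : k) * gaussBinom (q : k) (x.2 + y.2) x.2) •
      path q (x.1 + y.1) (x.2 + y.2)) (i, l)
  rw [mulMap, path, h]
  exact (basis q).constr_basis k _ (j, m)

theorem mulMap_assoc (x y z : LinPath q) :
    mulMap q (mulMap q x y) z = mulMap q x (mulMap q y z) := by
  have h : (mulMap q).compr₂ (mulMap q) =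
      (LinearMap.llcomp k (LinPath q) (LinPath q) (LinPath q)).compl₁₂ (mulMap q) (mulMap q) := by
    refine (basis q).ext fun x => (basis q).ext fun y => (basis q).ext fun z => ?_
    obtain ⟨i, l⟩ := x
    obtain ⟨j, m⟩ := y
    obtain ⟨n, r⟩ := z
    simp only [basis_apply, LinearMap.compr₂_apply, LinearMap.compl₁₂_apply,
      LinearMap.llcomp_apply, mulMap_path, map_smul, LinearMap.smul_apply, smul_smul]
    rw [add_assoc i j n, ← add_assoc l m r]
    congr 1
    have e : ((q ^ (i * (m : ℤ)) : kˣ) : k) * ((q ^ ((i + j) * (r : ℤ)) : kˣ) : k) =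
        ((q ^ (j * (r : ℤ)) : kˣ) : k) * ((q ^ (i * ((m + r : ℕ) : ℤ)) : kˣ) : k) := by
      rw [← Units.val_mul, ← Units.val_mul, ← zpow_add, ← zpow_add]
      congr 2
      push_cast
      ring
    have t := gaussBinom_trinomial (q : k) l m r
    rw [← add_assoc] at t
    linear_combination (gaussBinom (q : k) (l + m) l * gaussBinom (q : k) (l + m + r) (l + m)) * e +
      ((q ^ (j * (r : ℤ)) : kˣ) : k) * ((q ^ (i * ((m + r : ℕ) : ℤ)) : kˣ) : k) * t
  exact LinearMap.congr_fun (LinearMap.congr_fun (LinearMap.congr_fun h x) y) z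

instance : Ring (LinPath q) where
  __ := (inferInstance : AddCommGroup (LinPath q))
  mul x y := mulMap q x y
  one := path q 0 0
  left_distrib x y z := map_add (mulMap q x) y z
  right_distrib x y z := by
    change mulMap q (x + y) z = mulMap q x z + mulMap q y z
    simp
  zero_mul x := by change mulMap q 0 x = 0; simp
  mul_zero x := by change mulMap q x 0 = 0; simp
  one_mul x := by
    suffices h : mulMap q (path q 0 0) = LinearMap.id by
      exact LinearMap.congr_fun h x
    refine (basis q).ext fun y => ?_
    rw [basis_apply, mulMap_path]
    simp
  mul_one x := by
    suffices h : (mulMap q).flip (path q 0 0) = LinearMap.id by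
      exact LinearMap.congr_fun h x
    refine (basis q).ext fun y => ?_
    rw [basis_apply, LinearMap.flip_apply, mulMap_path]
    simp
  mul_assoc x y z := by
    exact mulMap_assoc q x y z

theorem mul_def (x y : LinPath q) : x * y = mulMap q x y := rfl

theorem one_def : (1 : LinPath q) = path q 0 0 := rfl

theorem path_mul_path (i j : ℤ) (l m : ℕ) : path q i l * path q j m =
    (((q ^ (i * (m : ℤ)) : kˣ) : k) * gaussBinom (q : k) (l + m) l) • path q (i + j) (l + m) :=
  mulMap_path q i j l m

instance : Algebra k (LinPath q) :=
  Algebra.ofModule (fun r x y => by simp [mul_def]) (fun r x y => by simp [mul_def])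

instance : Coalgebra k (LinPath q) where
  comul := comulMap q
  counit := counitMap q
  coassoc := by
    refine (basis q).ext fun ⟨i, l⟩ => ?_
    simp only [basis_apply, LinearMap.comp_apply, comulMap_path, map_sum,
      LinearMap.rTensor_tmul, LinearMap.lTensor_tmul, TensorProduct.sum_tmul,
      TensorProduct.tmul_sum, LinearEquiv.coe_coe, TensorProduct.assoc_tmul]
    rw [Finset.sum_sigma', Finset.sum_sigma']
    refine Finset.sum_nbij' (fun x => ⟨(x.1.1 + x.2.1, x.2.2), (x.1.1, x.2.1)⟩)
      (fun x => ⟨(x.2.1, x.2.2 + x.1.2), (x.2.2, x.1.2)⟩) ?_ ?_ ?_ ?_ ?_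
    · rintro ⟨⟨a, b⟩, ⟨c, e⟩⟩
      simp only [Finset.mem_sigma, mem_antidiagonal]
      rintro ⟨h1, h2⟩
      exact ⟨by omega, trivial⟩
    · rintro ⟨⟨a, b⟩, ⟨c, e⟩⟩
      simp only [Finset.mem_sigma, mem_antidiagonal]
      rintro ⟨h1, h2⟩
      exact ⟨by omega, trivial⟩
    · rintro ⟨⟨a, b⟩, ⟨c, e⟩⟩
      simp only [Finset.mem_sigma, mem_antidiagonal]
      rintro ⟨rfl, rfl⟩
      rfl
    · rintro ⟨⟨a, b⟩, ⟨c, e⟩⟩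
      simp only [Finset.mem_sigma, mem_antidiagonal]
      rintro ⟨rfl, rfl⟩
      rfl
    · rintro ⟨⟨a, b⟩, ⟨c, e⟩⟩ _
      simp [add_assoc]
  rTensor_counit_comp_comul := by
    refine (basis q).ext fun p => ?_
    simp only [basis_apply, LinearMap.comp_apply, comulMap_path, map_sum,
      LinearMap.rTensor_tmul, counitMap_path, TensorProduct.mk_apply]
    rw [Finset.sum_eq_single (p.2, 0)]
    · simp
    · rintro ⟨a, b⟩ hx hne
      have : b ≠ 0 := by
        rintro rfl
        simp only [mem_antidiagonal] at hx
        exact hne (by simp [← hx])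
      simp [this]
    · intro h; simp at h
  lTensor_counit_comp_comul := by
    refine (basis q).ext fun p => ?_
    simp only [basis_apply, LinearMap.comp_apply, comulMap_path, map_sum,
      LinearMap.lTensor_tmul, counitMap_path, LinearMap.flip_apply, TensorProduct.mk_apply]
    rw [Finset.sum_eq_single (0, p.2)]
    · simp
    · rintro ⟨a, b⟩ hx hne
      have : a ≠ 0 := by
        rintro rfl
        simp only [mem_antidiagonal] at hx
        exact hne (by simp [← hx])
      simp [this]
    · intro h; simp at h

theorem comul_path (i : ℤ) (l : ℕ) : Coalgebra.comul (R := k) (path q i l) =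
    ∑ x ∈ antidiagonal l, path q (i + x.1) x.2 ⊗ₜ[k] path q i x.1 :=
  comulMap_path q i l

theorem counit_path (i : ℤ) (l : ℕ) :
    Coalgebra.counit (R := k) (path q i l) = if l = 0 then 1 else 0 :=
  counitMap_path q i l

instance : Bialgebra k (LinPath q) where
  counit_one := by rw [one_def, counit_path]; simp
  mul_compr₂_counit := by
    refine (basis q).ext fun x => (basis q).ext fun y => ?_
    obtain ⟨i, l⟩ := x
    obtain ⟨j, m⟩ := y
    simp only [basis_apply, LinearMap.compr₂_apply, LinearMap.compl₁₂_apply,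
      LinearMap.mul_apply', path_mul_path, map_smul, counit_path]
    rcases Nat.eq_zero_or_pos l with rfl | hl
    · rcases Nat.eq_zero_or_pos m with rfl | hm
      · simp
      · simp [hm.ne']
    · simp [hl.ne']
  comul_one := by
    rw [one_def, comul_path]
    simp [Algebra.TensorProduct.one_def, one_def]
  mul_compr₂_comul := by
    refine (basis q).ext fun x => (basis q).ext fun y => ?_
    obtain ⟨i, l⟩ := x
    obtain ⟨j, m⟩ := y
    simp only [basis_apply, LinearMap.compr₂_apply, LinearMap.compl₁₂_apply,
      LinearMap.mul_apply', path_mul_path, map_smul, comul_path, Finset.sum_mul_sum,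
      Algebra.TensorProduct.tmul_mul_tmul]
    have h := gaussBinom_vandermonde (q : k) l m
      (fun a b => path q (i + j + a) b ⊗ₜ[k] path q (i + j) a)
    rw [mul_smul, ← h, Finset.smul_sum]
    refine Finset.sum_congr rfl fun x _ => ?_
    rw [Finset.smul_sum]
    refine Finset.sum_congr rfl fun y hy => ?_
    obtain rfl := mem_antidiagonal.mp hy
    have e : i + (x.1 : ℤ) + (j + (y.1 : ℤ)) = i + j + ((x.1 + y.1 : ℕ) : ℤ) := by
      push_cast; ring
    rw [TensorProduct.smul_tmul_smul, smul_smul, e]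
    congr 1
    have e2 : ((q ^ (i * ((y.1 + y.2 : ℕ) : ℤ)) : kˣ) : k) * (q : k) ^ (x.1 * y.2) =
        ((q ^ ((i + (x.1 : ℤ)) * (y.2 : ℤ)) : kˣ) : k) * ((q ^ (i * (y.1 : ℤ)) : kˣ) : k) := by
      rw [← Units.val_pow_eq_pow_val, ← Units.val_mul, ← Units.val_mul, ← zpow_natCast,
        ← zpow_add, ← zpow_add]
      congr 2
      push_cast
      ring
    linear_combination (gaussBinom (q : k) (x.2 + y.2) x.2 *
      gaussBinom (q : k) (x.1 + y.1) x.1) * e2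

end LinPath

/-! ### Finite dimensional right comodules -/

/-- A finite dimensional right comodule over the coalgebra `A`. -/
structure FdComodule (k : Type u) (A : Type v) [Field k] [AddCommGroup A] [Module k A]
    [Coalgebra k A] where
  /-- the underlying vector space -/
  carrier : Type u
  [addCommGroup : AddCommGroup carrier]
  [module : Module k carrier]
  [finite : Module.Finite k carrier]
  /-- the comodule structure map -/
  coact : carrier →ₗ[k] carrier ⊗[k] A
  coassoc : TensorProduct.assoc k carrier A A ∘ₗ coact.rTensor A ∘ₗ coact =
    (Coalgebra.comul (R := k) (A := A)).lTensor carrier ∘ₗ coact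
  counit_coact : (Coalgebra.counit (R := k) (A := A)).lTensor carrier ∘ₗ coact =
    (TensorProduct.mk k carrier k).flip 1

namespace FdComodule

attribute [instance] FdComodule.addCommGroup FdComodule.module FdComodule.finite

section coalg

variable {k : Type u} {A : Type v} [Field k] [AddCommGroup A] [Module k A] [Coalgebra k A]

/-- Two comodules are isomorphic if there is a linear isomorphism that commutes with the
comodule structure maps. -/
def Isomorphic (X Y : FdComodule k A) : Prop :=
  ∃ φ : X.carrier ≃ₗ[k] Y.carrier,
    (φ : X.carrier →ₗ[k] Y.carrier).rTensor A ∘ₗ X.coact =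
      Y.coact ∘ₗ (φ : X.carrier →ₗ[k] Y.carrier)

theorem coassoc_apply (X : FdComodule k A) (x : X.carrier) :
    TensorProduct.assoc k X.carrier A A (X.coact.rTensor A (X.coact x)) =
      (Coalgebra.comul (R := k) (A := A)).lTensor X.carrier (X.coact x) :=
  LinearMap.congr_fun X.coassoc x

theorem counit_coact_apply (X : FdComodule k A) (x : X.carrier) :
    (Coalgebra.counit (R := k) (A := A)).lTensor X.carrier (X.coact x) = x ⊗ₜ 1 :=
  LinearMap.congr_fun X.counit_coact x

/-- If `j` commutes with the coactions `δ` and `δ'`, then coassociativity of `δ` at `x` gives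
coassociativity of `δ'` at `j x`. -/
theorem coassoc_transfer {V W : Type u} [AddCommGroup V] [Module k V] [AddCommGroup W] [Module k W]
    (δ : V →ₗ[k] V ⊗[k] A) (δ' : W →ₗ[k] W ⊗[k] A) (j : V →ₗ[k] W)
    (hj : ∀ x, δ' (j x) = j.rTensor A (δ x)) (x : V)
    (hx : TensorProduct.assoc k V A A (δ.rTensor A (δ x)) =
      (Coalgebra.comul (R := k) (A := A)).lTensor V (δ x)) :
    TensorProduct.assoc k W A A (δ'.rTensor A (δ' (j x))) =
      (Coalgebra.comul (R := k) (A := A)).lTensor W (δ' (j x)) := by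
  have e1 : δ'.rTensor A (j.rTensor A (δ x)) = (j.rTensor A).rTensor A (δ.rTensor A (δ x)) := by
    rw [← LinearMap.rTensor_comp_apply, ← LinearMap.rTensor_comp_apply]
    congr 2
    exact LinearMap.ext hj
  have e2 : ∀ t : (V ⊗[k] A) ⊗[k] A, TensorProduct.assoc k W A A ((j.rTensor A).rTensor A t) =
      j.rTensor (A ⊗[k] A) (TensorProduct.assoc k V A A t) := by
    intro t
    have : (TensorProduct.assoc k W A A).toLinearMap ∘ₗ (j.rTensor A).rTensor A =
        j.rTensor (A ⊗[k] A) ∘ₗ (TensorProduct.assoc k V A A).toLinearMap :=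
      TensorProduct.ext_threefold fun _ _ _ => rfl
    exact LinearMap.congr_fun this t
  rw [hj, e1, e2, hx]
  exact LinearMap.congr_fun ((LinearMap.rTensor_comp_lTensor _ _ _).trans
    (LinearMap.lTensor_comp_rTensor _ _ _).symm) (δ x)

theorem counit_transfer {V W : Type u} [AddCommGroup V] [Module k V] [AddCommGroup W] [Module k W]
    (δ : V →ₗ[k] V ⊗[k] A) (δ' : W →ₗ[k] W ⊗[k] A) (j : V →ₗ[k] W)
    (hj : ∀ x, δ' (j x) = j.rTensor A (δ x)) (x : V)
    (hx : (Coalgebra.counit (R := k) (A := A)).lTensor V (δ x) = x ⊗ₜ 1) :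
    (Coalgebra.counit (R := k) (A := A)).lTensor W (δ' (j x)) = j x ⊗ₜ 1 := by
  have h : (Coalgebra.counit (R := k) (A := A)).lTensor W (j.rTensor A (δ x)) =
      j.rTensor k ((Coalgebra.counit (R := k) (A := A)).lTensor V (δ x))  :=
    LinearMap.congr_fun ((LinearMap.lTensor_comp_rTensor _ _ _).trans
      (LinearMap.rTensor_comp_lTensor _ _ _).symm) (δ x)
  rw [hj, h, hx, LinearMap.rTensor_tmul]

/-- The comodule structure map of a binary direct sum. -/
def addCoact (X Y : FdComodule k A) :
    X.carrier × Y.carrier →ₗ[k] (X.carrier × Y.carrier) ⊗[k] A :=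
  ((LinearMap.inl k X.carrier Y.carrier).rTensor A ∘ₗ X.coact).coprod
    ((LinearMap.inr k X.carrier Y.carrier).rTensor A ∘ₗ Y.coact)

theorem addCoact_inl (X Y : FdComodule k A) (x : X.carrier) :
    addCoact X Y (LinearMap.inl k _ _ x) = (LinearMap.inl k _ _).rTensor A (X.coact x) := by
  simp [addCoact]

theorem addCoact_inr (X Y : FdComodule k A) (y : Y.carrier) :
    addCoact X Y (LinearMap.inr k _ _ y) = (LinearMap.inr k _ _).rTensor A (Y.coact y) := by
  simp [addCoact]

/-- The direct sum of two comodules. -/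
def add (X Y : FdComodule k A) : FdComodule k A where
  carrier := X.carrier × Y.carrier
  coact := addCoact X Y
  coassoc := LinearMap.prod_ext
    (LinearMap.ext fun x => coassoc_transfer _ _ _ (addCoact_inl X Y) x (X.coassoc_apply x))
    (LinearMap.ext fun y => coassoc_transfer _ _ _ (addCoact_inr X Y) y (Y.coassoc_apply y))
  counit_coact := LinearMap.prod_ext
    (LinearMap.ext fun x => counit_transfer _ _ _ (addCoact_inl X Y) x (X.counit_coact_apply x))
    (LinearMap.ext fun y => counit_transfer _ _ _ (addCoact_inr X Y) y (Y.counit_coact_apply y))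

/-- The comodule structure map of the direct sum of the comodules `X i` with `i ∈ s`. -/
def sumCoact (s : Finset ℕ) (X : ℕ → FdComodule k A) :
    ((i : s) → (X i).carrier) →ₗ[k] ((i : s) → (X i).carrier) ⊗[k] A :=
  LinearMap.lsum k (fun i : s => (X i).carrier) k fun i =>
    (LinearMap.single k (fun i : s => (X i).carrier) i).rTensor A ∘ₗ (X i).coact

theorem sumCoact_single (s : Finset ℕ) (X : ℕ → FdComodule k A) (i : s) (x : (X i).carrier) :
    sumCoact s X (LinearMap.single k (fun i : s => (X i).carrier) i x) =
      (LinearMap.single k (fun i : s => (X i).carrier) i).rTensor A ((X i).coact x) := by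
  exact LinearMap.lsum_piSingle k (fun i : s => (X i).carrier) k _ i x

/-- The direct sum of the comodules `X i` with `i ∈ s`; it is `0` if `s` is empty. -/
def sum (s : Finset ℕ) (X : ℕ → FdComodule k A) : FdComodule k A where
  carrier := (i : s) → (X i).carrier
  coact := sumCoact s X
  coassoc := LinearMap.pi_ext' fun i => LinearMap.ext fun x =>
    coassoc_transfer _ _ _ (sumCoact_single s X i) x ((X i).coassoc_apply x)
  counit_coact := LinearMap.pi_ext' fun i => LinearMap.ext fun x =>
    counit_transfer _ _ _ (sumCoact_single s X i) x ((X i).counit_coact_apply x)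

end coalg

section bialg

variable {k : Type u} {A : Type v} [Field k] [Ring A] [Bialgebra k A]

/-- The map `(u ⊗ a) ⊗ (v ⊗ b) ↦ (u ⊗ v) ⊗ ab`. -/
def mulRight (k : Type u) (A : Type v) (V W : Type u) [Field k] [Ring A] [Algebra k A]
    [AddCommGroup V] [Module k V] [AddCommGroup W] [Module k W] :
    (V ⊗[k] A) ⊗[k] (W ⊗[k] A) →ₗ[k] (V ⊗[k] W) ⊗[k] A :=
  (LinearMap.mul' k A).lTensor (V ⊗[k] W) ∘ₗ
    (TensorProduct.tensorTensorTensorComm k V A W A).toLinearMap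

theorem mulRight_tmul (V W : Type u) [AddCommGroup V] [Module k V] [AddCommGroup W] [Module k W]
    (x : V) (y : W) (a b : A) :
    mulRight k A V W ((x ⊗ₜ a) ⊗ₜ (y ⊗ₜ b)) = (x ⊗ₜ y) ⊗ₜ (a * b) := by
  simp [mulRight]

/-- The comodule structure map `u ⊗ v ↦ (u₀ ⊗ v₀) ⊗ u₁v₁` of the tensor product. -/
def tensorCoact (X Y : FdComodule k A) :
    X.carrier ⊗[k] Y.carrier →ₗ[k] (X.carrier ⊗[k] Y.carrier) ⊗[k] A :=
  mulRight k A X.carrier Y.carrier ∘ₗ TensorProduct.map X.coact Y.coact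

/-- The tensor product of two comodules over a bialgebra. -/
def tensor (X Y : FdComodule k A) : FdComodule k A where
  carrier := X.carrier ⊗[k] Y.carrier
  coact := tensorCoact X Y
  coassoc := by
    refine TensorProduct.ext' fun x y => ?_
    have h1 : ∀ (s : X.carrier ⊗[k] A) (t : Y.carrier ⊗[k] A),
        TensorProduct.assoc k (X.carrier ⊗[k] Y.carrier) A A
          ((tensorCoact X Y).rTensor A (mulRight k A X.carrier Y.carrier (s ⊗ₜ t))) =
        mulRight k (A ⊗[k] A) X.carrier Y.carrier
          (TensorProduct.assoc k X.carrier A A (X.coact.rTensor A s) ⊗ₜ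
            TensorProduct.assoc k Y.carrier A A (Y.coact.rTensor A t)) := by
      intro s t
      induction s with
      | zero => simp
      | add s s' hs hs' => simp only [TensorProduct.add_tmul, map_add, hs, hs']
      | tmul u a =>
        induction t with
        | zero => simp
        | add t t' ht ht' => simp only [TensorProduct.tmul_add, map_add, ht, ht']
        | tmul w b =>
          rw [mulRight_tmul, LinearMap.rTensor_tmul, LinearMap.rTensor_tmul,
            LinearMap.rTensor_tmul, tensorCoact, LinearMap.comp_apply, TensorProduct.map_tmul]
          generalize X.coact u = s
          generalize Y.coact w = t
          induction s with
          | zero => simp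
          | add s s' hs hs' => simp only [TensorProduct.add_tmul, map_add, hs, hs']
          | tmul u' a' =>
            induction t with
            | zero => simp
            | add t t' ht ht' =>
              simp only [TensorProduct.tmul_add, TensorProduct.add_tmul, map_add, ht, ht']
            | tmul w' b' =>
              rw [mulRight_tmul, TensorProduct.assoc_tmul, TensorProduct.assoc_tmul,
                TensorProduct.assoc_tmul, mulRight_tmul, Algebra.TensorProduct.tmul_mul_tmul]
    have h2 : ∀ (s : X.carrier ⊗[k] A) (t : Y.carrier ⊗[k] A),
        (Coalgebra.comul (R := k) (A := A)).lTensor (X.carrier ⊗[k] Y.carrier)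
          (mulRight k A X.carrier Y.carrier (s ⊗ₜ t)) =
        mulRight k (A ⊗[k] A) X.carrier Y.carrier
          ((Coalgebra.comul (R := k) (A := A)).lTensor X.carrier s ⊗ₜ
            (Coalgebra.comul (R := k) (A := A)).lTensor Y.carrier t) := by
      intro s t
      induction s with
      | zero => simp
      | add s s' hs hs' => simp only [TensorProduct.add_tmul, map_add, hs, hs']
      | tmul u a =>
        induction t with
        | zero => simp
        | add t t' ht ht' => simp only [TensorProduct.tmul_add, map_add, ht, ht']
        | tmul w b =>
          rw [mulRight_tmul, LinearMap.lTensor_tmul, LinearMap.lTensor_tmul,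
            LinearMap.lTensor_tmul, mulRight_tmul, Bialgebra.comul_mul]
    exact (h1 (X.coact x) (Y.coact y)).trans
      ((congrArg₂ (fun s t => mulRight k (A ⊗[k] A) X.carrier Y.carrier (s ⊗ₜ t))
        (X.coassoc_apply x) (Y.coassoc_apply y)).trans (h2 (X.coact x) (Y.coact y)).symm)
  counit_coact := by
    refine TensorProduct.ext' fun x y => ?_
    have h : ∀ (s : X.carrier ⊗[k] A) (t : Y.carrier ⊗[k] A),
        (Coalgebra.counit (R := k) (A := A)).lTensor (X.carrier ⊗[k] Y.carrier)
          (mulRight k A X.carrier Y.carrier (s ⊗ₜ t)) =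
        mulRight k k X.carrier Y.carrier
          ((Coalgebra.counit (R := k) (A := A)).lTensor X.carrier s ⊗ₜ
            (Coalgebra.counit (R := k) (A := A)).lTensor Y.carrier t) := by
      intro s t
      induction s with
      | zero => simp
      | add s s' hs hs' => simp only [TensorProduct.add_tmul, map_add, hs, hs']
      | tmul u a =>
        induction t with
        | zero => simp
        | add t t' ht ht' => simp only [TensorProduct.tmul_add, map_add, ht, ht']
        | tmul w b =>
          rw [mulRight_tmul, LinearMap.lTensor_tmul, LinearMap.lTensor_tmul,
            LinearMap.lTensor_tmul, mulRight_tmul, Bialgebra.counit_mul]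
    have h' := h (X.coact x) (Y.coact y)
    rw [X.counit_coact_apply, Y.counit_coact_apply, mulRight_tmul, mul_one] at h'
    exact h'

end bialg

end FdComodule

/-! ### The indecomposable comodules `V(i, l)` -/

/-- The comodule structure map of `V(i, l)`: it sends the basis vector `v_m` to
`∑_{m ≤ j ≤ l} v_j ⊗ p`, where `p` is the path of length `j - m` starting at `i + m`. -/
def stringCoact {k : Type u} [Field k] (q : kˣ) (i : ℤ) (l : ℕ) :
    (Fin (l + 1) → k) →ₗ[k] (Fin (l + 1) → k) ⊗[k] LinPath q :=
  (Pi.basisFun k (Fin (l + 1))).constr k fun m =>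
    ∑ j ∈ Finset.Ici m, Pi.single j 1 ⊗ₜ[k] LinPath.path q (i + (m : ℕ)) ((j : ℕ) - (m : ℕ))

theorem stringCoact_single {k : Type u} [Field k] (q : kˣ) (i : ℤ) (l : ℕ) (m : Fin (l + 1)) :
    stringCoact q i l (Pi.single m 1) =
      ∑ j ∈ Finset.Ici m, Pi.single j 1 ⊗ₜ[k] LinPath.path q (i + (m : ℕ)) ((j : ℕ) - (m : ℕ)) := by
  rw [← Pi.basisFun_apply k, stringCoact, Module.Basis.constr_basis]

/-- The comodule `V(i, l)`, of dimension `l + 1`, with socle at the vertex `i + l` and top at the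
vertex `i`. -/
def stringComodule {k : Type u} [Field k] (q : kˣ) (i : ℤ) (l : ℕ) :
    FdComodule k (LinPath q) where
  carrier := Fin (l + 1) → k
  coact := stringCoact q i l
  coassoc := by
    refine (Pi.basisFun k (Fin (l + 1))).ext fun m => ?_
    rw [Pi.basisFun_apply]
    simp only [LinearMap.comp_apply, stringCoact_single, map_sum, LinearMap.rTensor_tmul,
      LinearMap.lTensor_tmul, LinPath.comul_path, TensorProduct.sum_tmul,
      TensorProduct.tmul_sum, LinearEquiv.coe_coe, TensorProduct.assoc_tmul]
    rw [Finset.sum_sigma', Finset.sum_sigma']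
    refine Finset.sum_nbij'
      (fun x => ⟨x.2, ((x.1 : ℕ) - (m : ℕ), (x.2 : ℕ) - (x.1 : ℕ))⟩)
      (fun x => ⟨⟨min ((m : ℕ) + x.2.1) l, by omega⟩, x.1⟩) ?_ ?_ ?_ ?_ ?_
    · rintro ⟨j, n⟩
      simp only [Finset.mem_sigma, Finset.mem_Ici, Fin.le_def,
        Finset.HasAntidiagonal.mem_antidiagonal]
      omega
    · rintro ⟨j, c, c'⟩
      simp only [Finset.mem_sigma, Finset.mem_Ici, Fin.le_def,
        Finset.HasAntidiagonal.mem_antidiagonal]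
      omega
    · rintro ⟨j, n⟩
      simp only [Finset.mem_sigma, Finset.mem_Ici, Fin.le_def]
      rintro ⟨h1, h2⟩
      have := n.isLt
      congr 1
      apply Fin.ext
      dsimp only
      omega
    · rintro ⟨j, c, c'⟩
      simp only [Finset.mem_sigma, Finset.mem_Ici, Fin.le_def,
        Finset.HasAntidiagonal.mem_antidiagonal]
      rintro ⟨h1, h2⟩
      have := j.isLt
      congr 2 <;> omega
    · rintro ⟨j, n⟩
      simp only [Finset.mem_sigma, Finset.mem_Ici, Fin.le_def]
      rintro ⟨h1, h2⟩
      have e : i + ((m : ℕ) : ℤ) + (((j : ℕ) - (m : ℕ) : ℕ) : ℤ) = i + ((j : ℕ) : ℤ) := by omega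
      rw [e]
  counit_coact := by
    refine (Pi.basisFun k (Fin (l + 1))).ext fun m => ?_
    rw [Pi.basisFun_apply]
    simp only [LinearMap.comp_apply, stringCoact_single, map_sum,
      LinearMap.lTensor_tmul, LinPath.counit_path, LinearMap.flip_apply, TensorProduct.mk_apply]
    rw [Finset.sum_eq_single m]
    · simp
    · intro j hj hne
      have : (j : ℕ) - (m : ℕ) ≠ 0 := by
        have h1 : m ≤ j := Finset.mem_Ici.mp hj
        rw [Fin.le_def] at h1
        have h2 : (j : ℕ) ≠ m := fun h => hne (Fin.ext h)
        omega
      simp [this]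
    · intro h; simp at h

end

infixl:70 " ⊗ᶜ " => FdComodule.tensor
infixl:65 " ⊕ᶜ " => FdComodule.add
infix:50 " ≅ᶜ " => FdComodule.Isomorphic

noncomputable section

/-! ### The `q`-binomial theorem -/

section QBinomial

variable {R : Type u} [CommRing R] (q : R)

/-! A finite dimensional comodule over this path coalgebra amounts to a graded vector space with a
nilpotent operator `T` of degree one, and V(i, l) is a Jordan chain of l + 1 vectors starting in
degree i. In the tensor product of V(0, M) and V(0, N) the vectors v_a ⊗ v_b behave like the
monomials X^a Y^b of the quantum plane YX = qXY modulo X^(M+1) and Y^(N+1), and `T` is left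
multiplication by X + Y (`quantumRectangle`). The theorem describes the Jordan form of this
operator.

In degree s of the quantum plane the image of X + Y is the kernel of the functional `altSum`. Hence
one element with nonzero `altSum` in each degree s ≤ min(M, N) generates the tensor product under
`T` (`eq_top_of_generators`). Upper bounds for the lengths of the chains are enough: the chains give
a surjection from a direct sum of strings, and a count of dimensions makes it an isomorphism.

For generic q the generators come from an sl2-type argument. The operator `lower` has a scalar
commutator with `raise` in each degree, so the lowest weight array of degree s is killed by the
power M + N - 2s + 1 of `raise` on the rectangle, and its `altSum` is a power of q times the
Gaussian binomial of M + N - s + 1 over s. These identities hold over k[X] and are specialised at q.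
Gaussian binomials vanish at q to order 0 or 1, according to the carry out of the last base d digit
(`rootMultiplicity_gaussBinom`).

For s = td + i this leaves three constructions. Without a carry the lowest weight array itself
serves. With a carry that makes all its coefficients vanish at q, it is divided by X - q before
specialisation. Otherwise one uses X^α Y^β g(X^d, Y^d): at q the q-binomial theorem gives (X + Y)^d
= X^d + Y^d, so g can be the lowest weight array for q = 1, where characteristic 0 prevents
vanishing. The choice of α and β decides how many blocks of length d fit, which gives the chains
whose dimension is a multiple of d.

All constructions exist for both orders of the factors with the same degrees and lengths, so both
tensor products are isomorphic to the same sum. -/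

theorem mul_pow_of_qcomm {A : Type v} [Ring A] [Algebra R A] {X Y : A}
    (h : Y * X = q • (X * Y)) (n : ℕ) : Y * X ^ n = q ^ n • (X ^ n * Y) := by
  induction n with
  | zero => simp
  | succ n ih =>
    rw [pow_succ X, ← mul_assoc, ih, smul_mul_assoc, mul_assoc, h, mul_smul_comm, smul_smul,
      mul_assoc, pow_succ]

theorem add_pow_of_qcomm {A : Type v} [Ring A] [Algebra R A] {X Y : A}
    (h : Y * X = q • (X * Y)) (n : ℕ) :
    (X + Y) ^ n = ∑ p ∈ Finset.HasAntidiagonal.antidiagonal n,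
      gaussBinom q n p.1 • (X ^ p.1 * Y ^ p.2) := by
  induction n with
  | zero => simp
  | succ n ih =>
    -- One sum over the antidiagonal of n + 1, split at either end; one end term vanishes since the
    -- Gaussian binomial of n over n + 1 is 0. This shifts the terms produced by left multiplication
    -- by Y into the places that the Pascal recursion requires.
    have key := (Finset.Nat.sum_antidiagonal_succ (n := n)
      (f := fun p : ℕ × ℕ => (q ^ p.1 * gaussBinom q n p.1) • (X ^ p.1 * Y ^ p.2))).symm.trans
      (Finset.Nat.sum_antidiagonal_succ' (n := n)
      (f := fun p : ℕ × ℕ => (q ^ p.1 * gaussBinom q n p.1) • (X ^ p.1 * Y ^ p.2)))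
    simp only [gaussBinom_eq_zero q n (n + 1) (Nat.lt_succ_self n), mul_zero, zero_smul,
      zero_add] at key
    rw [pow_succ', ih, add_mul, Finset.mul_sum, Finset.mul_sum,
      Finset.Nat.sum_antidiagonal_succ]
    simp only [gaussBinom_succ_succ, add_smul, Finset.sum_add_distrib]
    have e1 : ∀ p : ℕ × ℕ, X * gaussBinom q n p.1 • (X ^ p.1 * Y ^ p.2) =
        gaussBinom q n p.1 • (X ^ (p.1 + 1) * Y ^ p.2) := fun p => by
      rw [mul_smul_comm, ← mul_assoc, pow_succ']
    have e2 : ∀ p : ℕ × ℕ, Y * gaussBinom q n p.1 • (X ^ p.1 * Y ^ p.2) =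
        (q ^ p.1 * gaussBinom q n p.1) • (X ^ p.1 * Y ^ (p.2 + 1)) := fun p => by
      rw [mul_smul_comm, ← mul_assoc, mul_pow_of_qcomm q h, smul_mul_assoc, mul_assoc, ← pow_succ',
        smul_smul, mul_comm]
    simp only [e1, e2]
    rw [← key]
    simp only [pow_zero, gaussBinom_zero_right, one_mul, mul_one, one_smul]
    abel

end QBinomial

/-! ### Further identities for Gaussian binomial coefficients -/

section Gauss

variable {R : Type u} [CommRing R] (q : R)

theorem qInt_succ (n : ℕ) : qInt q (n + 1) = qInt q n + q ^ n := by
  simp [qInt, Finset.sum_range_succ]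

/-- Geometric sum. It eliminates powers of q in favour of q-integers, and it detects roots of unity
through vanishing q-integers. -/
theorem pow_eq_one_add_mul_qInt (n : ℕ) : q ^ n = 1 + (q - 1) * qInt q n := by
  rw [qInt, mul_geom_sum]; ring

theorem qInt_one (n : ℕ) : qInt (1 : R) n = n := by simp [qInt]

theorem qFactorial_ne_zero [IsDomain R] (n : ℕ) (hq : ∀ i < n, qInt q (i + 1) ≠ 0) :
    qFactorial q n ≠ 0 := by
  rw [qFactorial, Finset.prod_ne_zero_iff]
  exact fun i hi => hq i (Finset.mem_range.mp hi)

/-- Absorption identity, obtained by cancelling q-factorials; this is why all q-integers are assumed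
nonzero. -/
theorem qInt_mul_gaussBinom [IsDomain R] (hq : ∀ n, qInt q (n + 1) ≠ 0) (n a : ℕ) :
    qInt q (a + 1) * gaussBinom q (n + 1) (a + 1) = qInt q (n + 1) * gaussBinom q n a := by
  rcases lt_or_ge n a with h | h
  · rw [gaussBinom_eq_zero q _ _ h, gaussBinom_eq_zero q _ _ (Nat.succ_lt_succ h)]; simp
  · obtain ⟨m, rfl⟩ := Nat.exists_eq_add_of_le h
    have h1 := gaussBinom_mul_qFactorial q a m
    have h2 := gaussBinom_mul_qFactorial q (a + 1) m
    rw [show a + 1 + m = a + m + 1 by omega, qFactorial_succ, qFactorial_succ, ← h1] at h2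
    apply mul_right_cancel₀ (mul_ne_zero (qFactorial_ne_zero q a fun i _ => hq i)
      (qFactorial_ne_zero q m fun i _ => hq i))
    linear_combination h2

/-- The complete homogeneous form of the `q`-Vandermonde identity. -/
theorem sum_gaussBinom_mul_gaussBinom (n₁ n₂ s : ℕ) :
    ∑ p ∈ Finset.HasAntidiagonal.antidiagonal s,
      q ^ (p.2 * (n₁ + 1)) * gaussBinom q (n₁ + p.1) p.1 * gaussBinom q (n₂ + p.2) p.2 =
    gaussBinom q (n₁ + n₂ + 1 + s) s := by
  -- The binomial of n + j over j is the complete homogeneous polynomial of degree j in 1, q, ...,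
  -- q^n, and this is its recursion on the last variable. The claim splits n₁ + n₂ + 2 variables
  -- into the first n₁ + 1 and the rest, which carry a common factor q^(n₁+1).
  have hrec : ∀ n j : ℕ, gaussBinom q (n + 1 + (j + 1)) (j + 1) =
      q ^ (n + 1) * gaussBinom q (n + 1 + j) j + gaussBinom q (n + (j + 1)) (j + 1) := by
    intro n j
    have := gaussBinom_pascal q j n
    rw [show j + 1 + (n + 1) = n + 1 + (j + 1) by omega, show j + (n + 1) = n + 1 + j by omega,
      show j + 1 + n = n + (j + 1) by omega] at this
    exact this
  induction n₂ generalizing s with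
  | zero =>
    induction s with
    | zero => simp
    | succ s ih =>
      rw [add_zero] at ih ⊢
      rw [Finset.Nat.sum_antidiagonal_succ', hrec, ← ih, Finset.mul_sum, add_comm]
      congr 1
      · refine Finset.sum_congr rfl fun p _ => ?_
        simp only [zero_add, gaussBinom_self]; ring
      · simp
  | succ n₂ ih =>
    induction s with
    | zero => simp
    | succ s ihs =>
      have h := ih (s + 1)
      rw [Finset.Nat.sum_antidiagonal_succ'] at h ⊢
      have split : ∀ p : ℕ × ℕ, q ^ ((p.2 + 1) * (n₁ + 1)) * gaussBinom q (n₁ + p.1) p.1 *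
          gaussBinom q (n₂ + 1 + (p.2 + 1)) (p.2 + 1) = q ^ (n₁ + n₂ + 1 + 1) *
          (q ^ (p.2 * (n₁ + 1)) * gaussBinom q (n₁ + p.1) p.1 *
            gaussBinom q (n₂ + 1 + p.2) p.2) + q ^ ((p.2 + 1) * (n₁ + 1)) *
            gaussBinom q (n₁ + p.1) p.1 * gaussBinom q (n₂ + (p.2 + 1)) (p.2 + 1) := fun p => by
        rw [hrec]; ring
      simp only [split, Finset.sum_add_distrib, ← Finset.mul_sum, ihs]
      rw [show n₁ + (n₂ + 1) + 1 + (s + 1) = n₁ + n₂ + 1 + 1 + (s + 1) by omega, hrec, ← h,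
        show n₁ + (n₂ + 1) + 1 + s = n₁ + n₂ + 1 + 1 + s by omega]
      simp only [gaussBinom_zero_right]
      ring

end Gauss

/-! ### The raising operator on the quantum plane -/

section Raise

variable {R : Type u} [CommRing R] (q : R)

/-- Multiplication by the first generator of the quantum plane, on arrays of coefficients. -/
def shiftFst (R : Type u) [CommRing R] : Module.End R (ℕ → ℕ → R) where
  toFun f a b := match a with
    | 0 => 0
    | a + 1 => f a b
  map_add' f g := by ext a b; cases a <;> simp
  map_smul' c f := by ext a b; cases a <;> simp

/-- Left multiplication by the second generator of the quantum plane, on arrays of coefficients. -/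
def twistSnd : Module.End R (ℕ → ℕ → R) where
  toFun f a b := match b with
    | 0 => 0
    | b + 1 => q ^ a * f a b
  map_add' f g := by ext a b; cases b <;> simp [mul_add]
  map_smul' c f := by ext a b; cases b <;> simp [mul_left_comm]

/-- Left multiplication by the sum of the generators of the quantum plane. -/
def raise : Module.End R (ℕ → ℕ → R) := shiftFst R + twistSnd q

variable (f : ℕ → ℕ → R) (a b : ℕ)

@[simp] theorem shiftFst_zero : shiftFst R f 0 b = 0 := rfl
@[simp] theorem shiftFst_succ : shiftFst R f (a + 1) b = f a b := rfl
@[simp] theorem twistSnd_zero : twistSnd q f a 0 = 0 := rfl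
@[simp] theorem twistSnd_succ : twistSnd q f a (b + 1) = q ^ a * f a b := rfl

theorem raise_apply : raise q f a b = shiftFst R f a b + twistSnd q f a b := rfl

/-- The relation YX = qXY of the quantum plane, which opens powers of `raise` to the q-binomial
theorem. -/
theorem twistSnd_mul_shiftFst : twistSnd q * shiftFst R = q • (shiftFst R * twistSnd q) := by
  refine LinearMap.ext fun f => ?_
  funext a b
  cases a <;> cases b <;>
    simp [Module.End.mul_apply, pow_succ, mul_left_comm, mul_comm]

theorem shiftFst_pow_apply (n : ℕ) :
    (shiftFst R ^ n) f a b = if n ≤ a then f (a - n) b else 0 := by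
  induction n generalizing a with
  | zero => simp
  | succ n ih =>
    rw [pow_succ', Module.End.mul_apply]
    cases a with
    | zero => simp
    | succ a => rw [shiftFst_succ, ih]; simp

theorem twistSnd_pow_apply (n : ℕ) :
    (twistSnd q ^ n) f a b = if n ≤ b then q ^ (a * n) * f a (b - n) else 0 := by
  induction n generalizing b with
  | zero => simp
  | succ n ih =>
    rw [pow_succ', Module.End.mul_apply]
    cases b with
    | zero => simp
    | succ b =>
      rw [twistSnd_succ, ih]
      simp only [Nat.add_le_add_iff_right, Nat.add_sub_add_right]
      split_ifs <;> ring

/-- An array of coefficients is homogeneous of degree `n` if it is supported on `a + b = n`. -/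
def IsHomogeneousArray (n : ℕ) (f : ℕ → ℕ → R) : Prop := ∀ a b, a + b ≠ n → f a b = 0

/-- The array vanishes at all `(a, b)` with `a ≤ M` and `b ≤ N`. -/
def VanishesOn (M N : ℕ) (f : ℕ → ℕ → R) : Prop := ∀ a b, a ≤ M → b ≤ N → f a b = 0

variable {q f}

theorem IsHomogeneousArray.raise {n : ℕ} (hf : IsHomogeneousArray n f) :
    IsHomogeneousArray (n + 1) (raise q f) := by
  intro a b hab
  rw [raise_apply]
  cases a <;> cases b <;> simp <;> rw [hf] <;> first | omega | simp
  rw [hf] <;> first | omega | simp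

theorem IsHomogeneousArray.raise_pow {n : ℕ} (hf : IsHomogeneousArray n f) (r : ℕ) :
    IsHomogeneousArray (n + r) ((_root_.raise q ^ r) f) := by
  induction r with
  | zero => simpa using hf
  | succ r ih => rw [pow_succ', Module.End.mul_apply]; exact ih.raise

/-- Both parts of `raise` only increase exponents, so an entry inside the rectangle is computed from
entries inside it. Thus `raise` descends to the quotient of the quantum plane. -/
theorem VanishesOn.raise {M N : ℕ} (hf : VanishesOn M N f) : VanishesOn M N (raise q f) := by
  intro a b ha hb
  rw [raise_apply]
  rcases a with _ | a <;> rcases b with _ | b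
  · simp
  · simp [hf 0 b ha (by omega)]
  · simp [hf a 0 (by omega) hb]
  · simp [hf a (b + 1) (by omega) hb, hf (a + 1) b ha (by omega)]

variable (q f) in
/-- The functional on arrays of degree `n` that vanishes on the image of `raise`. -/
def altSum (n : ℕ) : R := ∑ p ∈ Finset.HasAntidiagonal.antidiagonal n,
  (-1) ^ p.1 * q ^ (p.1.choose 2) * f p.1 p.2

variable (q) in
/-- There is an array whose part of degree `s` is not in the image of `raise`, and whose chain under
`raise` has length at most `l + 1` modulo the arrays vanishing for `a ≤ M`, `b ≤ N`. -/
def HasGenerator (M N s l : ℕ) : Prop := ∃ f : ℕ → ℕ → R,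
  altSum q f s ≠ 0 ∧ VanishesOn M N ((_root_.raise q ^ (l + 1)) f)

/-- The matrix entries of `raise` are powers of q, so `raise` commutes with specialisation.
Identities over k[X] reach the root of unity in this way. -/
theorem raise_map {S : Type v} [CommRing S] (φ : R →+* S) (g : ℕ → ℕ → R) :
    raise (φ q) (fun a b => φ (g a b)) = fun a b => φ (raise q g a b) := by
  funext a b
  cases a <;> cases b <;> simp [raise_apply]

theorem raise_pow_map {S : Type v} [CommRing S] (φ : R →+* S) (g : ℕ → ℕ → R) (n : ℕ) :
    (raise (φ q) ^ n) (fun a b => φ (g a b)) = fun a b => φ ((raise q ^ n) g a b) := by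
  induction n with
  | zero => rfl
  | succ n ih => rw [pow_succ', Module.End.mul_apply, ih, raise_map, pow_succ']; rfl

theorem altSum_map {S : Type v} [CommRing S] (φ : R →+* S) (g : ℕ → ℕ → R) (n : ℕ) :
    altSum (φ q) (fun a b => φ (g a b)) n = φ (altSum q g n) := by
  simp [altSum]

end Raise

/-! ### Lowest weight arrays -/

section Lowest

variable {R : Type u} [CommRing R] (q : R) (M N : ℕ)

/-- The lowering operator adjoint to `raise` on the rectangle `a ≤ M`, `b ≤ N`. -/
def lower (f : ℕ → ℕ → R) (a b : ℕ) : R :=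
  q ^ (N - b) * (qInt q (a + 1) * qInt q (M - a)) * f (a + 1) b +
    qInt q (b + 1) * qInt q (N - b) * f a (b + 1)

/-- The commutator of `lower` and `raise` is a scalar in each degree. -/
theorem lower_raise (f : ℕ → ℕ → R) {a b : ℕ} (ha : a ≤ M) (hb : b ≤ N) :
    lower q M N (raise q f) a b = raise q (lower q M N f) a b +
      (qInt q (M + N - (a + b)) - qInt q (a + b)) * f a b := by
  obtain ⟨x, rfl⟩ := Nat.exists_eq_add_of_le ha
  obtain ⟨y, rfl⟩ := Nat.exists_eq_add_of_le hb
  rw [show a + x + (b + y) - (a + b) = y + x by omega, qInt_add, qInt_add]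
  have h0 : qInt q 0 = 0 := by simp [qInt]
  -- With the powers of q rewritten through q-integers, both sides become polynomials in q and the
  -- q-integers of a, b, x, y. At the border of the rectangle the factor of M - a = 0 or N - b = 0
  -- removes the entries outside.
  have pa := pow_eq_one_add_mul_qInt q a
  have pb := pow_eq_one_add_mul_qInt q b
  have px := pow_eq_one_add_mul_qInt q x
  have py := pow_eq_one_add_mul_qInt q y
  rcases a with _ | a <;> rcases b with _ | b
  · simp only [lower, raise_apply, shiftFst_zero, shiftFst_succ, twistSnd_zero, twistSnd_succ,
      qInt_succ, h0, zero_add, pow_zero, Nat.sub_zero]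
    ring
  · simp only [lower, raise_apply, shiftFst_zero, shiftFst_succ, twistSnd_succ,
      h0, zero_add, pow_zero, Nat.sub_zero, add_tsub_cancel_left,
      show b + 1 + y - b = y + 1 by omega, qInt_succ q (b + 1), qInt_succ q y, qInt_succ q 0,
      pow_succ q y]
    rw [py, pb]; ring
  · simp only [lower, raise_apply, shiftFst_succ, twistSnd_zero, twistSnd_succ,
      h0, zero_add, pow_zero, Nat.sub_zero, add_tsub_cancel_left,
      show a + 1 + x - a = x + 1 by omega, qInt_succ q (a + 1), qInt_succ q x, qInt_succ q 0]
    rw [px, py, pa]; ring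
  · simp only [lower, raise_apply, shiftFst_succ, twistSnd_succ, add_tsub_cancel_left,
      show a + 1 + x - a = x + 1 by omega, show b + 1 + y - b = y + 1 by omega,
      qInt_succ q (a + 1), qInt_succ q (b + 1), qInt_succ q x, qInt_succ q y, pow_succ q y,
      pow_succ q (a + 1)]
    rw [px, py, pa, pb]; ring

/-- The lowest weight array of degree `s` in the rectangle `a ≤ M`, `b ≤ N`. -/
def lowestArray (s a b : ℕ) : R :=
  if a + b = s then (-1) ^ a * q ^ (∑ i ∈ Finset.range b, (N - i)) * gaussBinom q (N - b) a *
    gaussBinom q (M - a) b else 0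

theorem isHomogeneousArray_lowestArray (s : ℕ) :
    IsHomogeneousArray s (lowestArray q M N s) := fun a b h => by
  simp [lowestArray, h]

theorem map_lowestArray {S : Type v} [CommRing S] (φ : R →+* S) (s a b : ℕ) :
    φ (lowestArray q M N s a b) = lowestArray (φ q) M N s a b := by
  simp only [lowestArray]
  split_ifs <;> simp [map_gaussBinom]

variable {M N} {s : ℕ}

/-- The signs of array and functional cancel, the powers of q combine to a constant times
q^(b(N-s+1)), and what remains is the q-Vandermonde sum for N - s and M - s. -/
theorem altSum_lowestArray (hM : s ≤ M) (hN : s ≤ N) :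
    altSum q (lowestArray q M N s) s = q ^ (s.choose 2) * gaussBinom q (M + N - s + 1) s := by
  have h := sum_gaussBinom_mul_gaussBinom q (N - s) (M - s) s
  rw [show N - s + (M - s) + 1 + s = M + N - s + 1 by omega] at h
  rw [← h, altSum, Finset.mul_sum]
  refine Finset.sum_congr rfl fun p hp => ?_
  obtain ⟨a, b⟩ := p
  obtain rfl := Finset.HasAntidiagonal.mem_antidiagonal.mp hp
  obtain ⟨n, rfl⟩ := Nat.exists_eq_add_of_le hN
  dsimp only
  rw [lowestArray, if_pos rfl, show a + b + n - (a + b) + a = a + b + n - b by omega,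
    show M - (a + b) + b = M - a by omega]
  have e : a.choose 2 + ∑ i ∈ Finset.range b, (a + b + n - i) =
      (a + b).choose 2 + b * (a + b + n - (a + b) + 1) := by
    -- Partial sums, so that the induction on c can keep a + b + n fixed.
    have h1 : ∀ c ≤ b, a.choose 2 + ∑ i ∈ Finset.range c, (a + b + n - i) =
        (a + c).choose 2 + c * (b - c + n + 1) := by
      intro c
      induction c with
      | zero => simp
      | succ c ih =>
        intro hc
        have := ih (by omega)
        obtain ⟨t, rfl⟩ := Nat.exists_eq_add_of_le hc
        rw [Finset.sum_range_succ, ← add_assoc, this, ← add_assoc a c 1,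
          Nat.choose_succ_succ' (a + c) 1, Nat.choose_one_right,
          show a + (c + 1 + t) + n - c = a + t + n + 1 by omega,
          show c + 1 + t - c + n + 1 = t + n + 2 by omega,
          show c + 1 + t - (c + 1) + n + 1 = t + n + 1 by omega]
        ring
    rw [h1 b le_rfl, show b - b + n + 1 = a + b + n - (a + b) + 1 by omega]
  have e' := congrArg (fun t => q ^ t) e
  simp only [pow_add] at e'
  have sgn : ((-1 : R) ^ a) * (-1) ^ a = 1 := by rw [← mul_pow]; simp
  rw [← pow_add q ((a + b).choose 2)] at e'
  rw [pow_add] at e'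
  linear_combination (gaussBinom q (a + b + n - b) a * gaussBinom q (M - a) b) * e' +
    (q ^ (a.choose 2) * q ^ (∑ i ∈ Finset.range b, (a + b + n - i)) *
      gaussBinom q (a + b + n - b) a * gaussBinom q (M - a) b) * sgn

/-- The neighbouring coefficients at (a + 1, b) and (a, b + 1) have opposite signs, and the
absorption identity for each of the two binomials makes their contributions cancel. -/
theorem lower_lowestArray [IsDomain R] (hq : ∀ n, qInt q (n + 1) ≠ 0) (hM : s ≤ M) (hN : s ≤ N)
    (a b : ℕ) : lower q M N (lowestArray q M N s) a b = 0 := by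
  rw [lower, lowestArray, lowestArray]
  by_cases h : a + b + 1 = s
  · rw [if_pos (by omega), if_pos (by omega)]
    obtain ⟨x, rfl⟩ := Nat.exists_eq_add_of_le (show a + 1 ≤ M by omega)
    obtain ⟨y, rfl⟩ := Nat.exists_eq_add_of_le (show b + 1 ≤ N by omega)
    have h1 := qInt_mul_gaussBinom q hq y a
    have h2 := qInt_mul_gaussBinom q hq x b
    rw [Finset.sum_range_succ, pow_add, show b + 1 + y - b = y + 1 by omega,
      show a + 1 + x - a = x + 1 by omega, show b + 1 + y - (b + 1) = y by omega,
      show a + 1 + x - (a + 1) = x by omega]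
    linear_combination (-(-1) ^ a * q ^ (∑ i ∈ Finset.range b, (b + 1 + y - i)) * q ^ (y + 1) *
        qInt q (x + 1) * gaussBinom q x b) * h1 +
      (-1) ^ a * q ^ (∑ i ∈ Finset.range b, (b + 1 + y - i)) * q ^ (y + 1) *
        qInt q (y + 1) * gaussBinom q y a * h2
  · rw [if_neg (by omega), if_neg (by omega)]; simp

/-- Moving `lower` through the factors `raise` one at a time produces the commutator scalars of the
degrees s + j, which add up; the last term dies because `lower` kills x. The equality is restricted
to the rectangle because `lower_raise` is. -/
theorem vanishesOn_lower_raise_pow {x : ℕ → ℕ → R} (hx : IsHomogeneousArray s x)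
    (hl : ∀ a b, lower q M N x a b = 0) (r : ℕ) :
    VanishesOn M N (lower q M N ((raise q ^ (r + 1)) x) -
      (∑ j ∈ Finset.range (r + 1), (qInt q (M + N - (s + j)) - qInt q (s + j))) •
        (raise q ^ r) x) := by
  have scal : ∀ t a b, (qInt q (M + N - (a + b)) - qInt q (a + b)) * (raise q ^ t) x a b =
      (qInt q (M + N - (s + t)) - qInt q (s + t)) * (raise q ^ t) x a b := by
    intro t a b
    by_cases h : a + b = s + t
    · rw [h]
    · simp [hx.raise_pow t a b h]
  induction r with
  | zero =>
    intro a b ha hb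
    have h0 : raise q (lower q M N x) = 0 := by
      rw [show lower q M N x = 0 from funext fun a => funext fun b => hl a b, map_zero]
    have := scal 0 a b
    simp only [pow_zero, Module.End.one_apply] at this
    simp [lower_raise q M N x ha hb, h0, this]
  | succ r ih =>
    intro a b ha hb
    have h1 := ih.raise (q := q) a b ha hb
    rw [map_sub, map_smul, ← Module.End.mul_apply, ← pow_succ'] at h1
    rw [pow_succ' _ (r + 1), Module.End.mul_apply, Finset.sum_range_succ]
    simp only [Pi.sub_apply, Pi.smul_apply, smul_eq_mul] at h1 ⊢
    rw [lower_raise q M N _ ha hb, scal]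
    linear_combination h1

/-- The commutator scalars are antisymmetric about the middle degree and sum to 0, so `lower` kills
this power on the rectangle. Its degree M + N - s + 1 exceeds N, so the row a = 0 vanishes there,
and each equation of `lower` determines the next row from the previous one. -/
theorem vanishesOn_raise_pow_lowestArray_of_isDomain [IsDomain R] (hq0 : q ≠ 0)
    (hq : ∀ n, qInt q (n + 1) ≠ 0)
    (hM : s ≤ M) (hN : s ≤ N) :
    VanishesOn M N ((raise q ^ (M + N - 2 * s + 1)) (lowestArray q M N s)) := by
  have hhom := (isHomogeneousArray_lowestArray q M N s).raise_pow (q := q) (M + N - 2 * s + 1)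
  have h := vanishesOn_lower_raise_pow q (isHomogeneousArray_lowestArray q M N s)
    (lower_lowestArray q hq hM hN) (M + N - 2 * s)
  have hsum : ∑ j ∈ Finset.range (M + N - 2 * s + 1),
      (qInt q (M + N - (s + j)) - qInt q (s + j)) = 0 := by
    rw [Finset.sum_sub_distrib, sub_eq_zero,
      ← Finset.sum_range_reflect (fun j => qInt q (s + j))]
    refine Finset.sum_congr rfl fun j hj => ?_
    have := Finset.mem_range.mp hj
    congr 1
    omega
  rw [hsum, zero_smul, sub_zero] at h
  intro a
  induction a with
  | zero => exact fun b _ hb => hhom 0 b (by omega)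
  | succ a ih =>
    intro b ha hb
    by_cases hdeg : a + 1 + b = s + (M + N - 2 * s + 1)
    · have e := h a b (by omega) hb
      rw [lower] at e
      have hz : qInt q (b + 1) * qInt q (N - b) *
          (raise q ^ (M + N - 2 * s + 1)) (lowestArray q M N s) a (b + 1) = 0 := by
        -- For b = N the neighbour lies outside the rectangle, but its coefficient contains the
        -- q-integer of 0.
        rcases Nat.lt_or_ge b N with h' | h'
        · rw [ih (b + 1) (by omega) h', mul_zero]
        · simp [Nat.sub_eq_zero_of_le h', qInt]
      rw [hz, add_zero] at e
      obtain ⟨x, rfl⟩ := Nat.exists_eq_add_of_le ha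
      rw [show a + 1 + x - a = x + 1 by omega] at e
      exact (mul_eq_zero.mp e).resolve_left
        (mul_ne_zero (pow_ne_zero _ hq0) (mul_ne_zero (hq _) (hq _)))
    · exact hhom _ _ hdeg

end Lowest

/-! ### Generators at a root of unity -/

section Spread

variable {k : Type u} [Field k] {q : k} {d : ℕ}

/-- The q-integer of d vanishes at q while the smaller positive ones do not, so all inner
coefficients of the q-binomial expansion are 0. -/
theorem raise_pow_order (hd : 2 ≤ d) (hq : IsPrimitiveRoot q d) :
    raise q ^ d = shiftFst k ^ d + twistSnd q ^ d := by
  have hq' : ∀ i, i + 1 < d → qInt q (i + 1) ≠ 0 := by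
    intro i hi h0
    have h1 := pow_eq_one_add_mul_qInt q (i + 1)
    rw [h0, mul_zero, add_zero, hq.pow_eq_one_iff_dvd] at h1
    exact absurd (Nat.le_of_dvd (Nat.succ_pos i) h1) (by omega)
  obtain ⟨n, rfl⟩ := Nat.exists_eq_add_of_le' (show 1 ≤ d by omega)
  rw [raise, add_pow_of_qcomm q (twistSnd_mul_shiftFst q), Finset.Nat.sum_antidiagonal_succ]
  obtain ⟨n, rfl⟩ := Nat.exists_eq_add_of_le' (show 1 ≤ n by omega)
  rw [Finset.Nat.sum_antidiagonal_succ', Finset.sum_eq_zero]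
  · simp [add_comm]
  · rintro ⟨a, b⟩ hab
    have hab := Finset.HasAntidiagonal.mem_antidiagonal.mp hab
    dsimp only at hab
    have h1 := gaussBinom_mul_qFactorial q (a + 1) (b + 1)
    rw [show a + 1 + (b + 1) = n + 1 + 1 by omega] at h1
    have h0 : qFactorial q (n + 1 + 1) = 0 := by
      have h2 := pow_eq_one_add_mul_qInt q (n + 1 + 1)
      rw [hq.pow_eq_one, left_eq_add, mul_eq_zero, sub_eq_zero] at h2
      rw [qFactorial_succ, h2.resolve_left (hq.ne_one (by omega)), mul_zero]
    rw [h0] at h1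
    dsimp only
    rw [(mul_eq_zero.mp h1).resolve_right (mul_ne_zero
      (qFactorial_ne_zero q _ fun i hi => hq' i (by omega))
      (qFactorial_ne_zero q _ fun i hi => hq' i (by omega))), zero_smul]

/-- The array with the entries of `g` at the places `(α + d * a, β + d * b)`. -/
def spread {R : Type u} [CommRing R] (d α β : ℕ) (g : ℕ → ℕ → R) (a b : ℕ) : R :=
  if α ≤ a ∧ β ≤ b ∧ d ∣ a - α ∧ d ∣ b - β then g ((a - α) / d) ((b - β) / d) else 0

theorem spread_apply (hd : 2 ≤ d) (α β : ℕ) (g : ℕ → ℕ → k) (a b : ℕ) :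
    spread d α β g (α + d * a) (β + d * b) = g a b := by
  simp [spread, Nat.mul_div_cancel_left _ (show 0 < d by omega)]

/-- On X^α Y^β k[X^d, Y^d] the operator (X + Y)^d acts as X^d + Y^d, and the twist disappears
because q^(ad) = 1. Hence the classical case q = 1 governs the powers divisible by d. -/
theorem raise_pow_spread (hd : 2 ≤ d) (hq : IsPrimitiveRoot q d) (α β : ℕ) (g : ℕ → ℕ → k)
    (n : ℕ) : (raise q ^ (n * d)) (spread d α β g) = spread d α β ((raise 1 ^ n) g) := by
  have step : ∀ g : ℕ → ℕ → k, (raise q ^ d) (spread d α β g) = spread d α β (raise 1 g) := by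
    intro g
    have hd0 : 0 < d := by omega
    rw [raise_pow_order hd hq]
    funext a b
    rw [LinearMap.add_apply, Pi.add_apply, Pi.add_apply, shiftFst_pow_apply, twistSnd_pow_apply,
      mul_comm a d, pow_mul, hq.pow_eq_one, one_pow, one_mul]
    by_cases h : α ≤ a ∧ β ≤ b ∧ d ∣ a - α ∧ d ∣ b - β
    · obtain ⟨ha, hb, ⟨a', ha'⟩, ⟨b', hb'⟩⟩ := h
      obtain rfl : a = α + d * a' := by omega
      obtain rfl : b = β + d * b' := by omega
      rw [spread_apply hd, raise_apply]
      congr 1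
      · cases a' with
        | zero =>
          rw [shiftFst_zero]
          split_ifs with h
          · rw [spread, if_neg (by omega)]
          · rfl
        | succ a' =>
          rw [shiftFst_succ, if_pos (by rw [mul_add]; omega),
            show α + d * (a' + 1) - d = α + d * a' by rw [mul_add]; omega, spread_apply hd]
      · cases b' with
        | zero =>
          rw [twistSnd_zero]
          split_ifs with h
          · rw [spread, if_neg (by omega)]
          · rfl
        | succ b' =>
          rw [twistSnd_succ, if_pos (by rw [mul_add]; omega), one_pow, one_mul,
            show β + d * (b' + 1) - d = β + d * b' by rw [mul_add]; omega, spread_apply hd]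
    · have h1 : d ≤ a → spread d α β g (a - d) b = 0 := fun hda => by
        rw [spread, if_neg]
        rintro ⟨h1, h2, h3, h4⟩
        refine h ⟨by omega, h2, ?_, h4⟩
        rw [show a - α = a - d - α + d by omega]
        exact Dvd.dvd.add h3 dvd_rfl
      have h2 : d ≤ b → spread d α β g a (b - d) = 0 := fun hdb => by
        rw [spread, if_neg]
        rintro ⟨h1, h2, h3, h4⟩
        refine h ⟨h1, by omega, h3, ?_⟩
        rw [show b - β = b - d - β + d by omega]
        exact Dvd.dvd.add h4 dvd_rfl
      have h3 : spread d α β (raise 1 g) a b = 0 := by rw [spread, if_neg h]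
      rw [h3]
      split_ifs with h4 h5 h5 <;> simp [*]
  induction n with
  | zero => simp
  | succ n ih =>
    rw [add_mul, one_mul, add_comm, pow_add, Module.End.mul_apply, ih, step, pow_succ',
      Module.End.mul_apply]

/-- The power of q is the product of all d-th roots of unity, which is (-1)^(d-1). For even d the
proof uses q^(d/2) = -1. -/
theorem neg_one_pow_mul_pow_choose (hd : 2 ≤ d) (hq : IsPrimitiveRoot q d) :
    (-1) ^ d * q ^ d.choose 2 = -1 := by
  rw [Nat.choose_two_right]
  rcases Nat.even_or_odd' d with ⟨c, rfl | rfl⟩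
  · have h1 : q ^ c = -1 := by
      have h2 : q ^ c * q ^ c = 1 := by rw [← pow_add, ← two_mul, hq.pow_eq_one]
      refine (mul_self_eq_one_iff.mp h2).resolve_left fun h3 => ?_
      exact absurd (Nat.le_of_dvd (by omega) ((hq.pow_eq_one_iff_dvd c).mp h3)) (by omega)
    rw [mul_assoc, Nat.mul_div_cancel_left _ two_pos, pow_mul q, h1, pow_mul]
    have : Odd (2 * c - 1) := ⟨c - 1, by omega⟩
    simp [this.neg_one_pow]
  · rw [Nat.add_sub_cancel, mul_comm 2 c, ← mul_assoc, Nat.mul_div_cancel _ two_pos, mul_comm c 2,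
      pow_mul q, hq.pow_eq_one, one_pow, pow_succ, pow_mul]
    simp

/-- Along steps of length d the weights of `altSum` merely alternate in sign, as they do for q = 1.
-/
theorem neg_one_pow_mul_pow_choose_add (hd : 2 ≤ d) (hq : IsPrimitiveRoot q d) (α a : ℕ) :
    (-1) ^ (α + d * a) * q ^ (α + d * a).choose 2 = (-1) ^ a * ((-1) ^ α * q ^ α.choose 2) := by
  induction a with
  | zero => simp
  | succ a ih =>
    have e : ∀ n c : ℕ, (n + c).choose 2 = n.choose 2 + c.choose 2 + c * n := by
      intro n c
      induction c with
      | zero => simp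
      | succ c ih =>
        rw [← add_assoc, Nat.choose_succ_succ' (n + c) 1, ih, Nat.choose_succ_succ' c 1,
          Nat.choose_one_right, Nat.choose_one_right]
        ring
    rw [mul_add, mul_one, ← add_assoc, e, pow_add, pow_add q, pow_add q, pow_mul q d,
      hq.pow_eq_one, one_pow]
    have h := neg_one_pow_mul_pow_choose hd hq
    linear_combination ((-1) ^ (α + d * a) * q ^ (α + d * a).choose 2) * h - ih

/-- Only the sublattice contributes, and there the weights are those for q = 1 times a constant; for
nonzero q this constant is a unit. -/
theorem altSum_spread (hd : 2 ≤ d) (hq : IsPrimitiveRoot q d) (α β : ℕ) (g : ℕ → ℕ → k) (n : ℕ) :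
    altSum q (spread d α β g) (n * d + α + β) = (-1) ^ α * q ^ α.choose 2 * altSum 1 g n := by
  rw [altSum, altSum, Finset.mul_sum]
  symm
  refine Finset.sum_of_injOn (fun p => (α + d * p.1, β + d * p.2)) ?_ ?_ ?_ ?_
  · rintro ⟨a, b⟩ _ ⟨a', b'⟩ _ h
    simp only [Prod.mk.injEq, Nat.add_left_cancel_iff] at h
    rw [Nat.eq_of_mul_eq_mul_left (by omega) h.1, Nat.eq_of_mul_eq_mul_left (by omega) h.2]
  · rintro ⟨a, b⟩ h
    simp only [Finset.mem_coe, Finset.HasAntidiagonal.mem_antidiagonal] at h ⊢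
    rw [← h]; ring
  · rintro ⟨a, b⟩ h h'
    rw [spread, if_neg, mul_zero]
    rintro ⟨h1, h2, ⟨a', h3⟩, ⟨b', h4⟩⟩
    refine h' ⟨(a', b'), ?_, ?_⟩
    · simp only [Finset.mem_coe, Finset.HasAntidiagonal.mem_antidiagonal] at h ⊢
      refine Nat.eq_of_mul_eq_mul_left (show 0 < d by omega) ?_
      rw [mul_add, mul_comm d n]
      omega
    · simp only [Prod.mk.injEq]; omega
  · rintro ⟨a, b⟩ _
    dsimp only
    rw [spread_apply hd, neg_one_pow_mul_pow_choose_add hd hq]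
    simp
    ring

end Spread

/-! ### Orders of vanishing at q and the three kinds of generators -/

section Generators

open Polynomial

variable {k : Type u} [Field k] [CharZero k] (q : k) {M N s d : ℕ}

theorem qInt_X_ne_zero (n : ℕ) : qInt (X : k[X]) (n + 1) ≠ 0 := by
  intro h
  have := congrArg (eval 1) h
  simp [qInt, eval_finsetSum] at this
  exact Nat.cast_add_one_ne_zero n this

theorem qFactorial_X_field_ne_zero (n : ℕ) : qFactorial (X : k[X]) n ≠ 0 :=
  qFactorial_ne_zero _ n fun i _ => qInt_X_ne_zero i

theorem gaussBinom_X_ne_zero (l m : ℕ) : gaussBinom (X : k[X]) (l + m) l ≠ 0 := fun h =>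
  qFactorial_X_field_ne_zero (k := k) (l + m) (by rw [← gaussBinom_mul_qFactorial, h, zero_mul])

/-- Proved over k[X], where no X-integer of positive index vanishes, and then evaluated. So q is
arbitrary here, including 1 and roots of unity. -/
theorem vanishesOn_raise_pow_lowestArray (hM : s ≤ M) (hN : s ≤ N) :
    VanishesOn M N ((raise q ^ (M + N - 2 * s + 1)) (lowestArray q M N s)) := by
  have h := vanishesOn_raise_pow_lowestArray_of_isDomain (X : k[X]) X_ne_zero qInt_X_ne_zero hM hN
  have e := raise_pow_map (q := (X : k[X])) (evalRingHom q) (lowestArray X M N s)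
    (M + N - 2 * s + 1)
  simp only [map_lowestArray, coe_evalRingHom, eval_X] at e
  intro a b ha hb
  have := congrFun (congrFun e a) b
  rw [h a b ha hb, eval_zero] at this
  exact this

variable {q}

/-- Multiplied by X - 1, which does not vanish at q, the X-integer becomes X^(n+1) - 1. In
characteristic 0 this is separable, so the only question is whether q is a root. -/
theorem rootMultiplicity_qInt (hd : 2 ≤ d) (hq : IsPrimitiveRoot q d) (n : ℕ) :
    rootMultiplicity q (qInt (X : k[X]) (n + 1)) = if d ∣ n + 1 then 1 else 0 := by
  have e : qInt (X : k[X]) (n + 1) * (X - 1) = X ^ (n + 1) - 1 := by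
    rw [pow_eq_one_add_mul_qInt (X : k[X]) (n + 1)]; ring
  have hne : (X ^ (n + 1) - 1 : k[X]) ≠ 0 := X_pow_sub_C_ne_zero (Nat.succ_pos n) 1
  have h1 : rootMultiplicity q (X - 1 : k[X]) = 0 := by
    apply rootMultiplicity_eq_zero
    simp only [IsRoot.def, eval_sub, eval_X, eval_one, sub_eq_zero]
    exact hq.ne_one (by omega)
  have h2 := congrArg (rootMultiplicity q) e
  rw [rootMultiplicity_mul (e ▸ hne), h1, add_zero] at h2
  rw [h2]
  split_ifs with h
  · apply le_antisymm
    · apply rootMultiplicity_le_one_of_separable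
      exact (X_pow_sub_one_separable_iff).mpr (Nat.cast_ne_zero.mpr (Nat.succ_ne_zero n))
    · rw [Nat.succ_le_iff, rootMultiplicity_pos hne]
      simp [IsRoot.def, (hq.pow_eq_one_iff_dvd _).mpr h]
  · apply rootMultiplicity_eq_zero
    simp only [IsRoot.def, eval_sub, eval_pow, eval_X, eval_one, sub_eq_zero]
    exact fun h' => h ((hq.pow_eq_one_iff_dvd _).mp h')

theorem rootMultiplicity_qFactorial (hd : 2 ≤ d) (hq : IsPrimitiveRoot q d) (n : ℕ) :
    rootMultiplicity q (qFactorial (X : k[X]) n) = n / d := by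
  induction n with
  | zero => simp [qFactorial]
  | succ n ih =>
    have hne := qFactorial_X_field_ne_zero (k := k) (n + 1)
    rw [qFactorial_succ] at hne ⊢
    rw [rootMultiplicity_mul hne, ih, rootMultiplicity_qInt hd hq, Nat.succ_div]

/-- The multiplicity is 1 or 0 according to whether adding l and m carries out of the last base d
digit. The additive form avoids truncated subtraction. -/
theorem rootMultiplicity_gaussBinom (hd : 2 ≤ d) (hq : IsPrimitiveRoot q d) (l m : ℕ) :
    rootMultiplicity q (gaussBinom (X : k[X]) (l + m) l) + (l / d + m / d) = (l + m) / d := by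
  have h := congrArg (rootMultiplicity q) (gaussBinom_mul_qFactorial (X : k[X]) l m)
  have h1 := mul_ne_zero (qFactorial_X_field_ne_zero (k := k) l)
    (qFactorial_X_field_ne_zero (k := k) m)
  rwa [rootMultiplicity_mul (mul_ne_zero (gaussBinom_X_ne_zero l m) h1), rootMultiplicity_mul h1,
    rootMultiplicity_qFactorial hd hq, rootMultiplicity_qFactorial hd hq,
    rootMultiplicity_qFactorial hd hq] at h

/-- The hypothesis `h` excludes a carry in adding s and M + N - 2s + 1, so the `altSum` of the
lowest weight array survives at q. -/
theorem hasGenerator_of_div_eq (hd : 2 ≤ d) (hq : IsPrimitiveRoot q d) (hM : s ≤ M) (hN : s ≤ N)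
    (h : (M + N - s + 1) / d = s / d + (M + N - 2 * s + 1) / d) :
    HasGenerator q M N s (M + N - 2 * s) := by
  refine ⟨lowestArray q M N s, ?_,
    vanishesOn_raise_pow_lowestArray q hM hN⟩
  rw [altSum_lowestArray q hM hN]
  refine mul_ne_zero (pow_ne_zero _ (hq.ne_zero (by omega))) fun h0 => ?_
  have hr := rootMultiplicity_gaussBinom hd hq s (M + N - 2 * s + 1)
  rw [show s + (M + N - 2 * s + 1) = M + N - s + 1 by omega] at hr
  have hne := gaussBinom_X_ne_zero (k := k) s (M + N - 2 * s + 1)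
  rw [show s + (M + N - 2 * s + 1) = M + N - s + 1 by omega] at hne
  have : 0 < rootMultiplicity q (gaussBinom (X : k[X]) (M + N - s + 1) s) := by
    rw [rootMultiplicity_pos hne, IsRoot.def, ← coe_evalRingHom, map_gaussBinom]
    simpa using h0
  omega

/-- By `h` the `altSum` of the lowest weight array has a simple zero at q; by `hc` each of its
coefficients also vanishes there, one of the two binomials having a carry. Division by X - q over
k[X] removes the zero and keeps the chain bound. -/
theorem hasGenerator_of_div_eq_succ (hd : 2 ≤ d) (hq : IsPrimitiveRoot q d) (hM : s ≤ M)
    (hN : s ≤ N) (h : (M + N - s + 1) / d = s / d + (M + N - 2 * s + 1) / d + 1)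
    (hc : ∀ a b, a + b = s → a / d + (N - s) / d + (b / d + (M - s) / d) <
      (N - b) / d + (M - a) / d) :
    HasGenerator q M N s (M + N - 2 * s) := by
  have hdvd : ∀ a b, X - C q ∣ lowestArray (X : k[X]) M N s a b := by
    intro a b
    rw [lowestArray]
    split_ifs with hab
    · have h1 := rootMultiplicity_gaussBinom hd hq a (N - s)
      have h2 := rootMultiplicity_gaussBinom hd hq b (M - s)
      have n1 := gaussBinom_X_ne_zero (k := k) a (N - s)
      have n2 := gaussBinom_X_ne_zero (k := k) b (M - s)
      rw [show a + (N - s) = N - b by omega] at h1 n1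
      rw [show b + (M - s) = M - a by omega] at h2 n2
      have h3 := hc a b hab
      rw [mul_assoc]
      apply dvd_mul_of_dvd_right
      rw [dvd_iff_isRoot, ← rootMultiplicity_pos (mul_ne_zero n1 n2),
        rootMultiplicity_mul (mul_ne_zero n1 n2)]
      omega
    · exact dvd_zero _
  choose g hg using hdvd
  have hX : (X - C q : k[X]) ≠ 0 := X_sub_C_ne_zero q
  have hlow : lowestArray (X : k[X]) M N s = (X - C q) • g := by
    funext a b; simp [hg]
  refine ⟨fun a b => evalRingHom q (g a b), ?_, fun a b ha hb => ?_⟩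
  · have e := altSum_map (q := (X : k[X])) (evalRingHom q) g s
    rw [coe_evalRingHom, eval_X] at e
    rw [coe_evalRingHom, e]
    intro h0
    obtain ⟨t, ht⟩ := dvd_iff_isRoot.mpr h0
    have ha := altSum_lowestArray (X : k[X]) hM hN
    have hs : altSum (X : k[X]) (lowestArray X M N s) s = (X - C q) * altSum X g s := by
      simp only [altSum, hg, Finset.mul_sum]
      exact Finset.sum_congr rfl fun p _ => by ring
    rw [hs, ht, ← mul_assoc, ← sq] at ha
    have hne := gaussBinom_X_ne_zero (k := k) s (M + N - 2 * s + 1)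
    have hr := rootMultiplicity_gaussBinom hd hq s (M + N - 2 * s + 1)
    rw [show s + (M + N - 2 * s + 1) = M + N - s + 1 by omega] at hr hne
    have hne' : (X : k[X]) ^ s.choose 2 * gaussBinom X (M + N - s + 1) s ≠ 0 :=
      mul_ne_zero (pow_ne_zero _ X_ne_zero) hne
    -- If `altSum` of the quotient vanished at q, the binomial would have a double zero there.
    have h2 := (le_rootMultiplicity_iff hne').mpr (Dvd.intro t ha)
    rw [rootMultiplicity_mul hne', rootMultiplicity_eq_zero (p := (X : k[X]) ^ s.choose 2)] at h2
    · omega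
    · simp [IsRoot.def, hq.ne_zero (show d ≠ 0 by omega)]
  · have e := raise_pow_map (q := (X : k[X])) (evalRingHom q) g (M + N - 2 * s + 1)
    rw [coe_evalRingHom, eval_X] at e
    rw [coe_evalRingHom, e]
    have h1 := vanishesOn_raise_pow_lowestArray_of_isDomain (X : k[X]) X_ne_zero qInt_X_ne_zero
      hM hN a b ha hb
    rw [hlow, map_smul] at h1
    dsimp only
    rw [(mul_eq_zero.mp h1).resolve_left hX, eval_zero]

theorem gaussBinom_one_ne_zero (l m : ℕ) : gaussBinom (1 : k) (l + m) l ≠ 0 := by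
  intro h
  have h1 := gaussBinom_mul_qFactorial (1 : k) l m
  rw [h, zero_mul] at h1
  exact qFactorial_ne_zero (1 : k) (l + m)
    (fun i _ => by rw [qInt_one]; exact Nat.cast_ne_zero.mpr (Nat.succ_ne_zero i)) h1.symm

/-- The generator is X^α Y^β g(X^d, Y^d), with g the lowest weight array for q = 1 on exponents
below m and below m'. There g is killed by the power m + m' - 1 - 2n of the classical operator,
hence the generator by d times that power; the final -1 turns the number of vectors into the length
of a string. -/
theorem hasGenerator_block (hd : 2 ≤ d) (hq : IsPrimitiveRoot q d) {α β n m m' : ℕ}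
    (h1 : n < m) (h2 : n < m') (hM : M < m * d + α) (hN : N < m' * d + β) :
    HasGenerator q M N (n * d + α + β) ((m + m' - 1 - 2 * n) * d - 1) := by
  obtain ⟨x, rfl⟩ := Nat.exists_eq_add_of_le' (show 1 ≤ m by omega)
  obtain ⟨y, rfl⟩ := Nat.exists_eq_add_of_le' (show 1 ≤ m' by omega)
  refine ⟨spread d α β (lowestArray 1 x y n), ?_, fun a b ha hb => ?_⟩
  · rw [altSum_spread hd hq, altSum_lowestArray _ (by omega) (by omega)]
    have := gaussBinom_one_ne_zero (k := k) n (x + y - 2 * n + 1)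
    rw [show n + (x + y - 2 * n + 1) = x + y - n + 1 by omega] at this
    simpa [hq.ne_zero (show d ≠ 0 by omega)] using this
  · have hpos : 1 ≤ (x + 1 + (y + 1) - 1 - 2 * n) * d := Nat.mul_pos (by omega) (by omega)
    rw [Nat.sub_add_cancel hpos, raise_pow_spread hd hq, spread]
    split_ifs with h
    · rw [show x + 1 + (y + 1) - 1 - 2 * n = x + y - 2 * n + 1 by omega]
      apply vanishesOn_raise_pow_lowestArray (1 : k) (show n ≤ x by omega) (show n ≤ y by omega)
      · exact Nat.lt_succ_iff.mp ((Nat.div_lt_iff_lt_mul (by omega)).mpr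
          (show a - α < (x + 1) * d by omega))
      · exact Nat.lt_succ_iff.mp ((Nat.div_lt_iff_lt_mul (by omega)).mpr
          (show b - β < (y + 1) * d by omega))
    · rfl

end Generators

namespace FdComodule

/-! ### Homomorphisms of comodules -/

section Hom

variable {k : Type u} {A : Type v} [Field k] [AddCommGroup A] [Module k A] [Coalgebra k A]

/-- A linear map that commutes with the comodule structure maps. -/
def IsHom (X Y : FdComodule k A) (φ : X.carrier →ₗ[k] Y.carrier) : Prop :=
  ∀ x, Y.coact (φ x) = φ.rTensor A (X.coact x)

variable {X Y Z : FdComodule k A}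

theorem Isomorphic.symm (h : X ≅ᶜ Y) : Y ≅ᶜ X := by
  obtain ⟨φ, hφ⟩ := h
  refine ⟨φ.symm, LinearMap.ext fun y => ?_⟩
  have h1 := LinearMap.congr_fun hφ (φ.symm y)
  simp only [LinearMap.comp_apply, LinearEquiv.coe_coe, LinearEquiv.apply_symm_apply] at h1 ⊢
  rw [← h1, ← LinearMap.rTensor_comp_apply, LinearEquiv.symm_comp, LinearMap.rTensor_id_apply]

theorem Isomorphic.trans (h : X ≅ᶜ Y) (h' : Y ≅ᶜ Z) : X ≅ᶜ Z := by
  obtain ⟨φ, hφ⟩ := h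
  obtain ⟨ψ, hψ⟩ := h'
  refine ⟨φ.trans ψ, LinearMap.ext fun x => ?_⟩
  have h1 := LinearMap.congr_fun hφ x
  have h2 := LinearMap.congr_fun hψ (φ x)
  simp only [LinearMap.comp_apply, LinearEquiv.coe_coe] at h1 h2
  simp only [LinearEquiv.coe_trans, LinearMap.rTensor_comp, LinearMap.comp_apply,
    LinearEquiv.coe_coe, h1, h2]

theorem IsHom.isomorphic {φ : X.carrier →ₗ[k] Y.carrier} (h : IsHom X Y φ)
    (hφ : Function.Surjective φ)
    (hr : Module.finrank k X.carrier = Module.finrank k Y.carrier) : X ≅ᶜ Y :=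
  ⟨LinearEquiv.ofBijective φ
    ⟨(LinearMap.injective_iff_surjective_of_finrank_eq_finrank hr).mpr hφ, hφ⟩,
    LinearMap.ext fun x => (h x).symm⟩

theorem IsHom.coprod {φ : X.carrier →ₗ[k] Z.carrier} {ψ : Y.carrier →ₗ[k] Z.carrier}
    (hφ : IsHom X Z φ) (hψ : IsHom Y Z ψ) : IsHom (X ⊕ᶜ Y) Z (φ.coprod ψ) := by
  have h : Z.coact ∘ₗ φ.coprod ψ = (φ.coprod ψ).rTensor A ∘ₗ addCoact X Y := by
    refine LinearMap.prod_ext (LinearMap.ext fun x => ?_) (LinearMap.ext fun y => ?_)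
    · simp only [LinearMap.comp_apply]
      have e : φ.coprod ψ (LinearMap.inl k X.carrier Y.carrier x) = φ x := by simp
      rw [addCoact_inl, ← LinearMap.rTensor_comp_apply, LinearMap.coprod_inl, e]
      exact hφ x
    · simp only [LinearMap.comp_apply]
      have e : φ.coprod ψ (LinearMap.inr k X.carrier Y.carrier y) = ψ y := by simp
      rw [addCoact_inr, ← LinearMap.rTensor_comp_apply, LinearMap.coprod_inr, e]
      exact hψ y
  exact LinearMap.congr_fun h

theorem IsHom.lsum {s : Finset ℕ} {X : ℕ → FdComodule k A}
    {φ : (i : s) → (X i).carrier →ₗ[k] Z.carrier} (hφ : ∀ i : s, IsHom (X i) Z (φ i)) :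
    IsHom (sum s X) Z (LinearMap.lsum k (fun i : s => (X i).carrier) k φ) := by
  have h : Z.coact ∘ₗ LinearMap.lsum k (fun i : s => (X i).carrier) k φ =
      (LinearMap.lsum k (fun i : s => (X i).carrier) k φ).rTensor A ∘ₗ sumCoact s X := by
    refine LinearMap.pi_ext' fun i => LinearMap.ext fun x => ?_
    have e : LinearMap.lsum k (fun i : s => (X i).carrier) k φ ∘ₗ
        LinearMap.single k (fun i : s => (X i).carrier) i = φ i :=
      LinearMap.ext fun x => LinearMap.lsum_piSingle k _ k φ i x
    simp only [LinearMap.comp_apply]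
    rw [sumCoact_single, ← LinearMap.rTensor_comp_apply, e,
      ← LinearMap.comp_apply (f := LinearMap.lsum k _ k φ), e]
    exact hφ i x
  exact LinearMap.congr_fun h

theorem finrank_add (X Y : FdComodule k A) : Module.finrank k (X ⊕ᶜ Y).carrier =
    Module.finrank k X.carrier + Module.finrank k Y.carrier :=
  Module.finrank_prod

theorem finrank_sum (s : Finset ℕ) (X : ℕ → FdComodule k A) :
    Module.finrank k (sum s X).carrier = ∑ i ∈ s, Module.finrank k (X i).carrier := by
  rw [← Finset.sum_coe_sort s]
  exact Module.finrank_pi_fintype k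

end Hom

/-! ### Strings as chains, and comodules that are quotients of the quantum plane -/

section Strings

variable {k : Type u} [Field k] {q : kˣ}

theorem finrank_stringComodule (i : ℤ) (l : ℕ) :
    Module.finrank k (stringComodule q i l).carrier = l + 1 :=
  (Module.finrank_fin_fun k : Module.finrank k (Fin (l + 1) → k) = l + 1)

theorem finrank_tensor_stringComodule (i j : ℤ) (l m : ℕ) :
    Module.finrank k (stringComodule q i l ⊗ᶜ stringComodule q j m).carrier =
      (l + 1) * (m + 1) := by
  have h : Module.finrank k ((Fin (l + 1) → k) ⊗[k] (Fin (m + 1) → k)) = (l + 1) * (m + 1) := by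
    rw [Module.finrank_tensorProduct, Module.finrank_fin_fun, Module.finrank_fin_fun]
  exact h

/-- A chain of vectors on which the coaction is given by shifting gives a homomorphism from a
string comodule. -/
theorem exists_isHom_stringComodule {W : FdComodule k (LinPath q)} (x : ℕ → W.carrier) (i : ℤ)
    (l n : ℕ) (hn : l < n) (hx : ∀ c, W.coact (x c) =
      ∑ r ∈ Finset.range n, x (c + r) ⊗ₜ[k] LinPath.path q (i + (c : ℕ)) r)
    (h0 : ∀ c, l < c → x c = 0) :
    ∃ φ : (stringComodule q i l).carrier →ₗ[k] W.carrier,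
      IsHom (stringComodule q i l) W φ ∧ ∀ c, x c ∈ LinearMap.range φ := by
  let φ : (Fin (l + 1) → k) →ₗ[k] W.carrier :=
    (Pi.basisFun k (Fin (l + 1))).constr k fun m => x m
  have hφ : ∀ m, φ (Pi.single m 1) = x m := fun m => by
    rw [← Pi.basisFun_apply k, Module.Basis.constr_basis]
  refine ⟨φ, ?_, fun c => ?_⟩
  · have h : W.coact ∘ₗ φ = φ.rTensor (LinPath q) ∘ₗ stringCoact q i l := by
      refine (Pi.basisFun k (Fin (l + 1))).ext fun m => ?_
      rw [Pi.basisFun_apply, LinearMap.comp_apply, LinearMap.comp_apply, stringCoact_single, hφ,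
        hx, map_sum]
      simp only [LinearMap.rTensor_tmul, hφ]
      symm
      refine Finset.sum_of_injOn (fun j => (j : ℕ) - (m : ℕ)) ?_ ?_ ?_ ?_
      · intro j hj j' hj' hjj
        simp only [Finset.mem_coe, Finset.mem_Ici, Fin.le_def] at hj hj'
        exact Fin.ext (by simp only at hjj; omega)
      · intro j hj
        simp only [Finset.coe_range, Set.mem_Iio]
        omega
      · intro r hr hr'
        rw [h0, TensorProduct.zero_tmul]
        by_contra hlt
        refine hr' ⟨⟨m + r, by omega⟩, ?_, ?_⟩
        · simp [Fin.le_def]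
        · simp
      · intro j hj
        simp only [Finset.mem_Ici, Fin.le_def] at hj
        rw [Nat.add_sub_cancel' hj]
    exact LinearMap.congr_fun h
  · rcases Nat.lt_or_ge l c with h | h
    · rw [h0 c h]; exact zero_mem _
    · exact ⟨Pi.single ⟨c, by omega⟩ 1, hφ _⟩

/-- The structure on a comodule that makes it a quotient of the quantum plane: vectors `e a b`,
vanishing outside of the rectangle `a ≤ M`, `b ≤ N`, and a raising operator `T` that determines
the coaction. -/
structure QuantumRectangle (q : kˣ) (M N : ℕ) (W : FdComodule k (LinPath q)) where
  /-- the image of the monomial with exponents `a` and `b` -/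
  e : ℕ → ℕ → W.carrier
  /-- the raising operator -/
  T : Module.End k W.carrier
  T_e : ∀ a b, T (e a b) = e (a + 1) b + (q : k) ^ a • e a (b + 1)
  e_fst : ∀ a b, M < a → e a b = 0
  e_snd : ∀ a b, N < b → e a b = 0
  coact_e : ∀ a b n, M + N < n → W.coact (e a b) =
    ∑ r ∈ Finset.range n, (T ^ r) (e a b) ⊗ₜ[k] LinPath.path q ((a + b : ℕ) : ℤ) r
  span_e : Submodule.span k (Set.range fun p : ℕ × ℕ => e p.1 p.2) = ⊤

namespace QuantumRectangle

variable {M N : ℕ} {W : FdComodule k (LinPath q)} (G : QuantumRectangle q M N W)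

/-- The image of the part of degree `n` of an array of coefficients. -/
def ofArray (n : ℕ) (f : ℕ → ℕ → k) : W.carrier :=
  ∑ p ∈ Finset.HasAntidiagonal.antidiagonal n, f p.1 p.2 • G.e p.1 p.2

theorem ofArray_eq_zero {f : ℕ → ℕ → k} (hf : VanishesOn M N f) (n : ℕ) : G.ofArray n f = 0 := by
  refine Finset.sum_eq_zero fun p _ => ?_
  rcases Nat.lt_or_ge M p.1 with h | h
  · rw [G.e_fst _ _ h, smul_zero]
  · rcases Nat.lt_or_ge N p.2 with h' | h'
    · rw [G.e_snd _ _ h', smul_zero]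
    · rw [hf _ _ h h', zero_smul]

/-- `T_e` is the rule for left multiplication of a monomial by X + Y, so passing from arrays to
vectors intertwines `raise` and `T`. -/
theorem T_ofArray (n : ℕ) (f : ℕ → ℕ → k) :
    G.T (G.ofArray n f) = G.ofArray (n + 1) (raise (q : k) f) := by
  simp only [ofArray, raise_apply, add_smul, Finset.sum_add_distrib, map_sum, map_smul, G.T_e,
    smul_add]
  rw [Finset.Nat.sum_antidiagonal_succ, Finset.Nat.sum_antidiagonal_succ']
  simp only [shiftFst_zero, shiftFst_succ, twistSnd_zero, twistSnd_succ, zero_smul, zero_add,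
    smul_smul, mul_comm]

theorem T_pow_ofArray (n r : ℕ) (f : ℕ → ℕ → k) :
    (G.T ^ r) (G.ofArray n f) = G.ofArray (n + r) ((raise (q : k) ^ r) f) := by
  induction r with
  | zero => simp
  | succ r ih =>
    rw [pow_succ', Module.End.mul_apply, ih, T_ofArray, pow_succ', Module.End.mul_apply, add_assoc]

theorem coact_ofArray (s n : ℕ) (hn : M + N < n) (f : ℕ → ℕ → k) : W.coact (G.ofArray s f) =
    ∑ r ∈ Finset.range n, G.ofArray (s + r) ((raise (q : k) ^ r) f) ⊗ₜ[k]
      LinPath.path q (s : ℤ) r := by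
  simp only [← T_pow_ofArray]
  simp only [ofArray, map_sum, map_smul, TensorProduct.sum_tmul]
  rw [Finset.sum_comm]
  refine Finset.sum_congr rfl fun p hp => ?_
  rw [G.coact_e _ _ n hn, Finset.smul_sum, Finset.HasAntidiagonal.mem_antidiagonal.mp hp]
  simp only [TensorProduct.smul_tmul']

/-- Generators in all degrees up to `M` or `N` span. -/
theorem eq_top_of_generators {U : Submodule k W.carrier} (hT : ∀ x ∈ U, G.T x ∈ U)
    (h : ∀ s, s ≤ M → s ≤ N → ∃ f, altSum (q : k) f s ≠ 0 ∧ G.ofArray s f ∈ U) : U = ⊤ := by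
  have key : ∀ n a b, a + b = n → G.e a b ∈ U := by
    intro n
    induction n with
    | zero =>
      intro a b hab
      obtain ⟨rfl, rfl⟩ : a = 0 ∧ b = 0 := by omega
      obtain ⟨f, hf, hU⟩ := h 0 (Nat.zero_le _) (Nat.zero_le _)
      simp only [altSum, ofArray, Finset.HasAntidiagonal.antidiagonal_zero,
        Finset.sum_singleton] at hf hU
      refine (Submodule.smul_mem_iff _ ?_).mp hU
      simpa using hf
    | succ n ih =>
      -- `T` applied to a monomial of degree n lies in U and relates two neighbouring monomials of
      -- degree n + 1. Modulo U they are all multiples of Y^(n+1), with the weights of `altSum` as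
      -- factors.
      have rel : ∀ a b, a + b = n + 1 →
          G.e a b - ((-1) ^ a * (q : k) ^ a.choose 2) • G.e 0 (n + 1) ∈ U := by
        intro a
        induction a with
        | zero => intro b hb; obtain rfl : b = n + 1 := by omega
                  simp
        | succ a iha =>
          intro b hab
          have h1 := iha (b + 1) (by omega)
          have h2 := hT _ (ih a b (by omega))
          rw [G.T_e] at h2
          have h3 := U.sub_mem h2 (U.smul_mem ((q : k) ^ a) h1)
          convert h3 using 1
          rw [Nat.choose_succ_succ' a 1, Nat.choose_one_right, pow_add, pow_succ (-1 : k)]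
          module
      -- Either Y^(n+1) is 0, or X^(n+1) is 0 and is a unit multiple of Y^(n+1) modulo U, or there
      -- is a generator of this degree, congruent to its nonzero `altSum` times Y^(n+1).
      have hz : G.e 0 (n + 1) ∈ U := by
        rcases Nat.lt_or_ge N (n + 1) with hN | hN
        · rw [G.e_snd _ _ hN]; exact zero_mem _
        rcases Nat.lt_or_ge M (n + 1) with hM | hM
        · have h1 := rel (n + 1) 0 rfl
          rw [G.e_fst _ _ hM, zero_sub, neg_mem_iff] at h1
          refine (Submodule.smul_mem_iff _ ?_).mp h1
          simp
        · obtain ⟨f, hf, hU⟩ := h _ hM hN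
          refine (Submodule.smul_mem_iff _ hf).mp ?_
          have h1 : G.ofArray (n + 1) f - altSum (q : k) f (n + 1) • G.e 0 (n + 1) ∈ U := by
            rw [ofArray, altSum, Finset.sum_smul, ← Finset.sum_sub_distrib]
            refine Submodule.sum_mem _ fun p hp => ?_
            have h2 := U.smul_mem (f p.1 p.2)
              (rel p.1 p.2 (Finset.HasAntidiagonal.mem_antidiagonal.mp hp))
            convert h2 using 1
            module
          simpa using U.sub_mem hU h1
      intro a b hab
      simpa using U.add_mem (rel a b hab)
        (U.smul_mem ((-1) ^ a * (q : k) ^ a.choose 2) hz)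
  rw [eq_top_iff, ← G.span_e, Submodule.span_le]
  rintro _ ⟨p, rfl⟩
  exact key _ _ _ rfl

/-- There is a homomorphism from `Y` whose image contains generators of the degrees in `S`, together
with the chains that they generate. -/
def Generates (Y : FdComodule k (LinPath q)) (S : Set ℕ) : Prop :=
  ∃ φ : Y.carrier →ₗ[k] W.carrier, IsHom Y W φ ∧ ∀ s ∈ S, ∃ f, altSum (q : k) f s ≠ 0 ∧
    ∀ c, G.ofArray (s + c) ((raise (q : k) ^ c) f) ∈ LinearMap.range φ

variable {G}

theorem generates_stringComodule {s l : ℕ} {i : ℤ} (hi : i = s)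
    (h : HasGenerator (q : k) M N s l) : G.Generates (stringComodule q i l) {s} := by
  obtain ⟨f, hf, hv⟩ := h
  have hv' : ∀ c, VanishesOn M N ((raise (q : k) ^ (l + 1 + c)) f) := by
    intro c
    induction c with
    | zero => exact hv
    | succ c ih => rw [← add_assoc, pow_succ', Module.End.mul_apply]; exact ih.raise
  -- The number of terms M + N + l + 1 exceeds both M + N, as the coaction formula requires, and l,
  -- as the string requires.
  obtain ⟨φ, h1, h2⟩ := exists_isHom_stringComodule
    (fun c => G.ofArray (s + c) ((raise (q : k) ^ c) f)) i l (M + N + l + 1) (by omega)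
    (fun c => by
      rw [G.coact_ofArray _ (M + N + l + 1) (by omega)]
      refine Finset.sum_congr rfl fun r _ => ?_
      rw [hi, add_assoc s c r, add_comm c r, pow_add, Module.End.mul_apply, Nat.cast_add])
    (fun c hc => by
      obtain ⟨c, rfl⟩ := Nat.exists_eq_add_of_lt hc
      rw [show l + c + 1 = l + 1 + c by omega]
      exact G.ofArray_eq_zero (hv' c) _)
  exact ⟨φ, h1, fun t ht => by rw [Set.mem_singleton_iff.mp ht]; exact ⟨f, hf, h2⟩⟩

theorem Generates.add {Y Z : FdComodule k (LinPath q)} {S S' : Set ℕ} (h : G.Generates Y S)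
    (h' : G.Generates Z S') : G.Generates (Y ⊕ᶜ Z) (S ∪ S') := by
  obtain ⟨φ, hφ, h⟩ := h
  obtain ⟨ψ, hψ, h'⟩ := h'
  refine ⟨φ.coprod ψ, hφ.coprod hψ, fun s hs => ?_⟩
  rcases hs with hs | hs
  · obtain ⟨f, hf, hr⟩ := h s hs
    refine ⟨f, hf, fun c => ?_⟩
    obtain ⟨y, hy⟩ := hr c
    exact ⟨(y, 0), show φ y + ψ 0 = _ by rw [map_zero, add_zero, hy]⟩
  · obtain ⟨f, hf, hr⟩ := h' s hs
    refine ⟨f, hf, fun c => ?_⟩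
    obtain ⟨y, hy⟩ := hr c
    exact ⟨(0, y), show φ 0 + ψ y = _ by rw [map_zero, zero_add, hy]⟩

theorem Generates.sum {Y : ℕ → FdComodule k (LinPath q)} {I : Finset ℕ} {S : ℕ → Set ℕ}
    (h : ∀ i ∈ I, G.Generates (Y i) (S i)) :
    G.Generates (FdComodule.sum I Y) {s | ∃ i ∈ I, s ∈ S i} := by
  choose φ hφ hr using h
  refine ⟨LinearMap.lsum k (fun i : I => (Y i).carrier) k fun i : I => φ i i.2,
    IsHom.lsum fun i : I => hφ i i.2, ?_⟩
  rintro s ⟨i, hi, hs⟩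
  obtain ⟨f, hf, hc⟩ := hr i hi s hs
  refine ⟨f, hf, fun c => ?_⟩
  obtain ⟨y, hy⟩ := hc c
  exact ⟨Pi.single (⟨i, hi⟩ : I) y,
    (LinearMap.lsum_piSingle k (fun i : I => (Y i).carrier) k _ ⟨i, hi⟩ y).trans hy⟩

/-- The image contains the `T`-stable span of the chains, which is everything. Equal dimensions then
give injectivity, so neither independence of the chains nor their exact lengths need a separate
proof. -/
theorem Generates.isomorphic {Y : FdComodule k (LinPath q)} {S : Set ℕ} (h : G.Generates Y S)
    (hS : ∀ s, s ≤ M → s ≤ N → s ∈ S)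
    (hr : Module.finrank k Y.carrier = Module.finrank k W.carrier) : Y ≅ᶜ W := by
  obtain ⟨φ, hφ, h⟩ := h
  refine hφ.isomorphic (LinearMap.range_eq_top.mp ?_) hr
  choose f hf hc using h
  let U : Submodule k W.carrier := Submodule.span k
    (Set.range fun p : S × ℕ => G.ofArray (p.1 + p.2) ((raise (q : k) ^ p.2) (f p.1 p.1.2)))
  have hle : U ≤ LinearMap.range φ := by
    rw [Submodule.span_le]
    rintro _ ⟨⟨s, c⟩, rfl⟩
    exact hc s s.2 c
  refine eq_top_iff.mpr (le_trans (eq_top_iff.mp ?_) hle)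
  refine G.eq_top_of_generators (fun x hx => ?_) fun s hM hN => ?_
  · suffices U ≤ U.comap G.T from this hx
    rw [Submodule.span_le]
    rintro _ ⟨⟨s, c⟩, rfl⟩
    refine Submodule.subset_span ⟨(s, c + 1), ?_⟩
    dsimp only
    rw [T_ofArray, ← add_assoc, pow_succ', Module.End.mul_apply]
  · exact ⟨f s (hS s hM hN), hf s _, Submodule.subset_span ⟨(⟨s, hS s hM hN⟩, 0), by simp⟩⟩

end QuantumRectangle

end Strings

end FdComodule

/-! ### The tensor product of two string comodules -/

section TensorStrings

variable {k : Type u} [Field k] (q : kˣ) (M N : ℕ)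

/-- The standard basis vector with index `a`, which is `0` for `a > M`. -/
def stringVec (k : Type u) [Field k] (M a : ℕ) : Fin (M + 1) → k :=
  if h : a < M + 1 then Pi.single ⟨a, h⟩ 1 else 0

theorem stringVec_of_lt {a : ℕ} (h : M < a) : stringVec k M a = 0 :=
  dif_neg (by omega)

theorem stringVec_coe (m : Fin (M + 1)) : stringVec k M m = Pi.single m 1 :=
  dif_pos m.2

theorem linearMap_ext_stringVec {M : ℕ} {W : Type v} [AddCommGroup W] [Module k W]
    {φ ψ : (Fin (M + 1) → k) →ₗ[k] W} (h : ∀ a, φ (stringVec k M a) = ψ (stringVec k M a)) :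
    φ = ψ := by
  refine (Pi.basisFun k (Fin (M + 1))).ext fun m => ?_
  rw [Pi.basisFun_apply, ← stringVec_coe]
  exact h m

/-- The shift of the standard basis. -/
def stringShift (k : Type u) [Field k] (M : ℕ) : Module.End k (Fin (M + 1) → k) :=
  (Pi.basisFun k (Fin (M + 1))).constr k fun m => stringVec k M (m + 1)

/-- The action of the grading on the standard basis. -/
def stringTwist : Module.End k (Fin (M + 1) → k) :=
  (Pi.basisFun k (Fin (M + 1))).constr k fun m => (q : k) ^ (m : ℕ) • stringVec k M m

theorem stringShift_stringVec (a : ℕ) :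
    stringShift k M (stringVec k M a) = stringVec k M (a + 1) := by
  rcases Nat.lt_or_ge M a with h | h
  · rw [stringVec_of_lt _ h, stringVec_of_lt _ (by omega), map_zero]
  · lift a to Fin (M + 1) using by omega
    rw [stringVec_coe, ← Pi.basisFun_apply k, stringShift, Module.Basis.constr_basis]

theorem stringTwist_stringVec (a : ℕ) :
    stringTwist q M (stringVec k M a) = (q : k) ^ a • stringVec k M a := by
  rcases Nat.lt_or_ge M a with h | h
  · rw [stringVec_of_lt _ h, map_zero, smul_zero]
  · lift a to Fin (M + 1) using by omega
    rw [stringVec_coe, ← Pi.basisFun_apply k, stringTwist, Module.Basis.constr_basis,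
      Pi.basisFun_apply, stringVec_coe]

theorem stringCoact_stringVec (a : ℕ) : stringCoact q 0 M (stringVec k M a) =
    ∑ j ∈ Finset.range (M + 1), stringVec k M (a + j) ⊗ₜ[k] LinPath.path q (a : ℤ) j := by
  rcases Nat.lt_or_ge M a with h | h
  · rw [stringVec_of_lt _ h, map_zero]
    refine (Finset.sum_eq_zero fun j _ => ?_).symm
    rw [stringVec_of_lt _ (by omega), TensorProduct.zero_tmul]
  · lift a to Fin (M + 1) using by omega
    rw [stringVec_coe, stringCoact_single, zero_add]
    refine Finset.sum_of_injOn (fun j => (j : ℕ) - (a : ℕ)) ?_ ?_ ?_ ?_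
    · intro j hj j' hj' hjj
      simp only [Finset.mem_coe, Finset.mem_Ici, Fin.le_def] at hj hj'
      exact Fin.ext (by simp only at hjj; omega)
    · intro j hj
      simp only [Finset.coe_range, Set.mem_Iio]
      omega
    · intro r hr hr'
      rw [stringVec_of_lt, TensorProduct.zero_tmul]
      by_contra hlt
      refine hr' ⟨⟨a + r, by omega⟩, ?_, ?_⟩
      · simp [Fin.le_def]
      · simp
    · intro j hj
      simp only [Finset.mem_Ici, Fin.le_def] at hj
      rw [Nat.add_sub_cancel' hj, stringVec_coe]

/-- The raising operator on the tensor product of two strings, first part. -/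
def tensorShift (k : Type u) [Field k] (M N : ℕ) :
    Module.End k ((Fin (M + 1) → k) ⊗[k] (Fin (N + 1) → k)) :=
  TensorProduct.map (stringShift k M) LinearMap.id

/-- The raising operator on the tensor product of two strings, second part. -/
def tensorTwist : Module.End k ((Fin (M + 1) → k) ⊗[k] (Fin (N + 1) → k)) :=
  TensorProduct.map (stringTwist q M) (stringShift k N)

/-- The standard basis of the tensor product of two strings. -/
def tensorVec (k : Type u) [Field k] (M N a b : ℕ) : (Fin (M + 1) → k) ⊗[k] (Fin (N + 1) → k) :=
  stringVec k M a ⊗ₜ stringVec k N b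

theorem tensorShift_tensorVec (a b : ℕ) :
    tensorShift k M N (tensorVec k M N a b) = tensorVec k M N (a + 1) b := by
  simp [tensorShift, tensorVec, stringShift_stringVec]

theorem tensorTwist_tensorVec (a b : ℕ) :
    tensorTwist q M N (tensorVec k M N a b) = (q : k) ^ a • tensorVec k M N a (b + 1) := by
  simp [tensorTwist, tensorVec, stringShift_stringVec, stringTwist_stringVec,
    TensorProduct.smul_tmul']

theorem tensorTwist_mul_tensorShift :
    tensorTwist q M N * tensorShift k M N = (q : k) • (tensorShift k M N * tensorTwist q M N) := by
  refine TensorProduct.ext (linearMap_ext_stringVec fun a => linearMap_ext_stringVec fun b => ?_)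
  change tensorTwist q M N (tensorShift k M N (tensorVec k M N a b)) =
    (q : k) • tensorShift k M N (tensorTwist q M N (tensorVec k M N a b))
  rw [tensorShift_tensorVec, tensorTwist_tensorVec, tensorTwist_tensorVec, map_smul,
    tensorShift_tensorVec, smul_smul, pow_succ']

theorem tensorShift_pow_mul_tensorTwist_pow (a b i j : ℕ) :
    (tensorShift k M N ^ i * tensorTwist q M N ^ j) (tensorVec k M N a b) =
      (q : k) ^ (a * j) • tensorVec k M N (a + i) (b + j) := by
  have h1 : ∀ j, (tensorTwist q M N ^ j) (tensorVec k M N a b) =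
      (q : k) ^ (a * j) • tensorVec k M N a (b + j) := by
    intro j
    induction j with
    | zero => simp
    | succ j ih =>
      rw [pow_succ', Module.End.mul_apply, ih, map_smul, tensorTwist_tensorVec, smul_smul,
        ← pow_add, mul_add, mul_one, add_assoc]
  have h2 : ∀ i, (tensorShift k M N ^ i) (tensorVec k M N a (b + j)) =
      tensorVec k M N (a + i) (b + j) := by
    intro i
    induction i with
    | zero => simp
    | succ i ih => rw [pow_succ', Module.End.mul_apply, ih, tensorShift_tensorVec, add_assoc]
  rw [Module.End.mul_apply, h1, map_smul, h2]

theorem raise_pow_tensorVec (a b r : ℕ) :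
    ((tensorShift k M N + tensorTwist q M N) ^ r) (tensorVec k M N a b) =
      ∑ p ∈ Finset.HasAntidiagonal.antidiagonal r, (gaussBinom (q : k) r p.1 * (q : k) ^ (a * p.2)) •
        tensorVec k M N (a + p.1) (b + p.2) := by
  refine (LinearMap.congr_fun (add_pow_of_qcomm (q : k)
    (A := Module.End k ((Fin (M + 1) → k) ⊗[k] (Fin (N + 1) → k)))
    (tensorTwist_mul_tensorShift q M N) r)
    (tensorVec k M N a b)).trans ?_
  rw [LinearMap.sum_apply]
  refine Finset.sum_congr rfl fun p _ => ?_
  rw [LinearMap.smul_apply, tensorShift_pow_mul_tensorTwist_pow, smul_smul]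

theorem tensorCoact_tensorVec (a b : ℕ) :
    FdComodule.tensorCoact (stringComodule q 0 M) (stringComodule q 0 N) (tensorVec k M N a b) =
      ∑ i ∈ Finset.range (M + 1), ∑ j ∈ Finset.range (N + 1),
        (gaussBinom (q : k) (i + j) i * (q : k) ^ (a * j)) •
          (tensorVec k M N (a + i) (b + j) ⊗ₜ[k] LinPath.path q ((a + b : ℕ) : ℤ) (i + j)) := by
  change FdComodule.mulRight k (LinPath q) _ _ (TensorProduct.map (stringCoact q 0 M)
    (stringCoact q 0 N) (stringVec k M a ⊗ₜ stringVec k N b)) = _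
  rw [TensorProduct.map_tmul, stringCoact_stringVec, stringCoact_stringVec,
    TensorProduct.sum_tmul]
  simp only [TensorProduct.tmul_sum, map_sum]
  refine Finset.sum_congr rfl fun i _ => Finset.sum_congr rfl fun j _ => ?_
  rw [FdComodule.mulRight_tmul, LinPath.path_mul_path, TensorProduct.tmul_smul, Nat.cast_add,
    mul_comm, ← Nat.cast_mul, zpow_natCast, Units.val_pow_eq_pow_val]
  rfl

/-- The product of paths of lengths i and j carries the factors gaussBinom (i + j) i and q^(aj),
which are the coefficients in the q-binomial expansion of `T` ^ (i + j). Grouping by r = i + j gives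
the claim; pairs outside the double sum contribute zero vectors. -/
theorem tensorCoact_tensorVec_eq_sum_range (a b n : ℕ) (hn : M + N < n) :
    FdComodule.tensorCoact (stringComodule q 0 M) (stringComodule q 0 N) (tensorVec k M N a b) =
      ∑ r ∈ Finset.range n, ((tensorShift k M N + tensorTwist q M N) ^ r) (tensorVec k M N a b) ⊗ₜ[k]
        LinPath.path q ((a + b : ℕ) : ℤ) r := by
  refine (tensorCoact_tensorVec q M N a b).trans ?_
  simp only [raise_pow_tensorVec, TensorProduct.sum_tmul]
  rw [← Finset.sum_product', Finset.sum_sigma']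
  refine Finset.sum_of_injOn (fun p => ⟨p.1 + p.2, p⟩) ?_ ?_ ?_ ?_
  · rintro p _ p' _ h
    exact (Sigma.mk.inj_iff.mp h).2.eq
  · rintro ⟨i, j⟩ h
    simp only [Finset.coe_product, Finset.coe_range, Set.mem_prod, Set.mem_Iio] at h
    simp only [Finset.mem_coe, Finset.mem_sigma, Finset.mem_range,
      Finset.HasAntidiagonal.mem_antidiagonal]
    exact ⟨by omega, trivial⟩
  · rintro ⟨r, i, j⟩ h h'
    simp only [Finset.mem_sigma, Finset.mem_range, Finset.HasAntidiagonal.mem_antidiagonal] at h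
    obtain ⟨_, rfl⟩ := h
    have : M < a + i ∨ N < b + j := by
      by_contra hc
      refine h' ⟨(i, j), ?_, rfl⟩
      simp only [Finset.coe_product, Finset.coe_range, Set.mem_prod, Set.mem_Iio]
      omega
    have hz : tensorVec k M N (a + i) (b + j) = 0 := by
      rcases this with h | h
      · rw [tensorVec, stringVec_of_lt _ h, TensorProduct.zero_tmul]
      · rw [tensorVec, stringVec_of_lt _ h, TensorProduct.tmul_zero]
    dsimp only
    rw [hz, smul_zero]
    exact TensorProduct.zero_tmul _ _
  · rintro ⟨i, j⟩ _
    dsimp only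
    rw [TensorProduct.smul_tmul']

theorem span_tensorVec :
    Submodule.span k (Set.range fun p : ℕ × ℕ => tensorVec k M N p.1 p.2) = ⊤ := by
  refine eq_top_iff.mpr ?_
  rw [← ((Pi.basisFun k (Fin (M + 1))).tensorProduct (Pi.basisFun k (Fin (N + 1)))).span_eq]
  refine Submodule.span_mono ?_
  rintro _ ⟨⟨i, j⟩, rfl⟩
  refine ⟨(i, j), ?_⟩
  dsimp only
  rw [Module.Basis.tensorProduct_apply, Pi.basisFun_apply, Pi.basisFun_apply, tensorVec,
    stringVec_coe, stringVec_coe]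

/-- The tensor product of two strings as a quotient of the quantum plane. -/
def quantumRectangle : FdComodule.QuantumRectangle q M N
    (stringComodule q 0 M ⊗ᶜ stringComodule q 0 N) where
  e := tensorVec k M N
  T := tensorShift k M N + tensorTwist q M N
  T_e a b := by
    change tensorShift k M N (tensorVec k M N a b) + tensorTwist q M N (tensorVec k M N a b) = _
    rw [tensorShift_tensorVec, tensorTwist_tensorVec]
    rfl
  e_fst a b h := by
    rw [tensorVec, stringVec_of_lt _ h, TensorProduct.zero_tmul]
    rfl
  e_snd a b h := by
    rw [tensorVec, stringVec_of_lt _ h, TensorProduct.tmul_zero]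
    rfl
  coact_e a b n hn := tensorCoact_tensorVec_eq_sum_range q M N a b n hn
  span_e := span_tensorVec M N

end TensorStrings

/-! ### Generators in both orders of the tensor factors -/

section Both

variable {k : Type u} [Field k]

/-- Generators exist for both orders of the tensor factors. -/
def HasGenerators (q : k) (M N s l : ℕ) : Prop := HasGenerator q M N s l ∧ HasGenerator q N M s l

variable [CharZero k] {q : k} {d e m f h : ℕ}

/-- The last base d digits of s and M + N - 2s + 1 are i and f + h + 1 - 2i, with sum f + h + 1 - i
< d: no carry. -/
theorem hasGenerators_low (hd : 2 ≤ d) (hq : IsPrimitiveRoot q d) {t i : ℕ} (ht : t ≤ e)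
    (ht' : t ≤ m) (hf : i ≤ f) (hh : i ≤ h) (hi : f + h + 1 < d + i) :
    HasGenerators q (e * d + f) (m * d + h) (t * d + i) ((e + m - 2 * t) * d + f + h - 2 * i) := by
  obtain ⟨x, rfl⟩ := Nat.exists_eq_add_of_le ht
  obtain ⟨y, rfl⟩ := Nat.exists_eq_add_of_le ht'
  have hd0 : 0 < d := by omega
  have key : ∀ A B, B < d → (A * d + B) / d = A := fun A B hB => by
    rw [mul_comm, Nat.mul_add_div hd0, Nat.div_eq_of_lt hB, add_zero]
  have e1 := key (t + x + y) (f + h + 1 - i) (by omega)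
  have e2 := key t i (by omega)
  have e3 := key (x + y) (f + h + 1 - 2 * i) (by omega)
  rw [show t + x + (t + y) - 2 * t = x + y by omega]
  simp only [add_mul] at *
  have g1 := hasGenerator_of_div_eq (M := t * d + x * d + f) (N := t * d + y * d + h)
    (s := t * d + i) hd hq (by omega) (by omega)
  have g2 := hasGenerator_of_div_eq (M := t * d + y * d + h) (N := t * d + x * d + f)
    (s := t * d + i) hd hq (by omega) (by omega)
  rw [show t * d + x * d + f + (t * d + y * d + h) - (t * d + i) + 1 =
      t * d + x * d + y * d + (f + h + 1 - i) by omega, e1, e2,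
    show t * d + x * d + f + (t * d + y * d + h) - 2 * (t * d + i) + 1 =
      x * d + y * d + (f + h + 1 - 2 * i) by omega, e3,
    show t * d + x * d + f + (t * d + y * d + h) - 2 * (t * d + i) =
      x * d + y * d + f + h - 2 * i by omega] at g1
  rw [show t * d + y * d + h + (t * d + x * d + f) - (t * d + i) + 1 =
      t * d + x * d + y * d + (f + h + 1 - i) by omega, e1, e2,
    show t * d + y * d + h + (t * d + x * d + f) - 2 * (t * d + i) + 1 =
      x * d + y * d + (f + h + 1 - 2 * i) by omega, e3,
    show t * d + y * d + h + (t * d + x * d + f) - 2 * (t * d + i) =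
      x * d + y * d + f + h - 2 * i by omega] at g2
  exact ⟨g1 (by omega), g2 (by omega)⟩

/-- Modulo d the numbers N - s and M - s leave d + h - i and d + f - i. If adding a to the first and
b to the second both failed to carry, the digits of a and b would sum to at most 2i - f - h - 2 < i,
although their sum is congruent to i modulo d. -/
theorem div_add_div_lt_of_carry {d f h x y t i a b : ℕ} (hf : f < i) (hh : h < i) (hi : i ≤ f + h + 1)
    (hid : i < d) (hab : a + b = t * d + i) :
    a / d + ((t + 1 + y) * d + h - (t * d + i)) / d + (b / d +
      ((t + 1 + x) * d + f - (t * d + i)) / d) <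
    ((t + 1 + y) * d + h - b) / d + ((t + 1 + x) * d + f - a) / d := by
  have hd0 : 0 < d := by omega
  have key : ∀ A B, B < d → (A * d + B) / d = A := fun A B hB => by
    rw [mul_comm, Nat.mul_add_div hd0, Nat.div_eq_of_lt hB, add_zero]
  have hN : (t + 1 + y) * d + h - (t * d + i) = y * d + (d + h - i) := by
    rw [add_mul, add_mul]; omega
  have hM : (t + 1 + x) * d + f - (t * d + i) = x * d + (d + f - i) := by
    rw [add_mul, add_mul]; omega
  have hNb : (t + 1 + y) * d + h - b = y * d + (d + h - i) + a := by omega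
  have hMa : (t + 1 + x) * d + f - a = x * d + (d + f - i) + b := by omega
  rw [hNb, hMa, hN, hM, key _ _ (by omega), key _ _ (by omega)]
  have ha := Nat.div_add_mod a d
  have hb := Nat.div_add_mod b d
  have la := Nat.mod_lt a hd0
  have lb := Nat.mod_lt b hd0
  have na : y * d + (d + h - i) + a = (y + a / d) * d + (d + h - i + a % d) := by
    rw [add_mul, mul_comm (a / d)]; omega
  have nb : x * d + (d + f - i) + b = (x + b / d) * d + (d + f - i + b % d) := by
    rw [add_mul, mul_comm (b / d)]; omega
  have carry : ∀ A B, d ≤ B → A + 1 ≤ (A * d + B) / d := fun A B hB => by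
    rw [Nat.le_div_iff_mul_le hd0, add_mul]; omega
  have nocarry : ∀ A B, A ≤ (A * d + B) / d := fun A B => by
    rw [Nat.le_div_iff_mul_le hd0]; omega
  have hmod : (a % d + b % d) % d = i := by
    rw [← Nat.add_mod, hab, add_comm, Nat.add_mul_mod_self_right, Nat.mod_eq_of_lt hid]
  have hge : i ≤ a % d + b % d := hmod ▸ Nat.mod_le _ _
  rw [na, nb]
  by_cases hc : d ≤ d + h - i + a % d
  · have := carry (y + a / d) _ hc
    have := nocarry (x + b / d) (d + f - i + b % d)
    omega
  · have := carry (x + b / d) (d + f - i + b % d) (by omega)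
    have := nocarry (y + a / d) (d + h - i + a % d)
    omega

/-- The last digits of s and M + N - 2s + 1 are now i and d + f + h + 1 - 2i, whose sum is at least
d. The carry gives a simple zero, and `div_add_div_lt_of_carry` makes every coefficient vanish too.
-/
theorem hasGenerators_high (hd : 2 ≤ d) (hq : IsPrimitiveRoot q d) {t i : ℕ} (ht : t < e)
    (ht' : t < m) (hf : f < i) (hh : h < i) (hi : i ≤ f + h + 1) (hid : i < d) :
    HasGenerators q (e * d + f) (m * d + h) (t * d + i) ((e + m - 2 * t) * d + f + h - 2 * i) := by
  obtain ⟨x, rfl⟩ := Nat.exists_eq_add_of_le (Nat.succ_le_of_lt ht)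
  obtain ⟨y, rfl⟩ := Nat.exists_eq_add_of_le (Nat.succ_le_of_lt ht')
  have hd0 : 0 < d := by omega
  have key : ∀ A B, B < d → (A * d + B) / d = A := fun A B hB => by
    rw [mul_comm, Nat.mul_add_div hd0, Nat.div_eq_of_lt hB, add_zero]
  have e1 := key (t + x + y + 2) (f + h + 1 - i) (by omega)
  have e2 := key t i (by omega)
  have e3 := key (x + y + 1) (d + f + h + 1 - 2 * i) (by omega)
  have c1 := fun a b => div_add_div_lt_of_carry (x := x) (y := y) (t := t) (a := a) (b := b)
    hf hh hi hid
  have c2 := fun a b => div_add_div_lt_of_carry (x := y) (y := x) (t := t) (a := a) (b := b)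
    hh hf (by omega) hid
  rw [show t.succ + x + (t.succ + y) - 2 * t = x + y + 2 by omega]
  simp only [Nat.succ_eq_add_one, add_mul, one_mul] at *
  have g1 := hasGenerator_of_div_eq_succ (M := t * d + d + x * d + f) (N := t * d + d + y * d + h)
    (s := t * d + i) hd hq (by omega) (by omega)
  have g2 := hasGenerator_of_div_eq_succ (M := t * d + d + y * d + h) (N := t * d + d + x * d + f)
    (s := t * d + i) hd hq (by omega) (by omega)
  rw [show t * d + d + x * d + f + (t * d + d + y * d + h) - (t * d + i) + 1 =
      t * d + x * d + y * d + 2 * d + (f + h + 1 - i) by omega, e1, e2,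
    show t * d + d + x * d + f + (t * d + d + y * d + h) - 2 * (t * d + i) + 1 =
      x * d + y * d + d + (d + f + h + 1 - 2 * i) by omega, e3,
    show t * d + d + x * d + f + (t * d + d + y * d + h) - 2 * (t * d + i) =
      x * d + y * d + 2 * d + f + h - 2 * i by omega] at g1
  rw [show t * d + d + y * d + h + (t * d + d + x * d + f) - (t * d + i) + 1 =
      t * d + x * d + y * d + 2 * d + (f + h + 1 - i) by omega, e1, e2,
    show t * d + d + y * d + h + (t * d + d + x * d + f) - 2 * (t * d + i) + 1 =
      x * d + y * d + d + (d + f + h + 1 - 2 * i) by omega, e3,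
    show t * d + d + y * d + h + (t * d + d + x * d + f) - 2 * (t * d + i) =
      x * d + y * d + 2 * d + f + h - 2 * i by omega] at g2
  exact ⟨g1 (by omega) c1, g2 (by omega) c2⟩

theorem hasGenerators_block (hd : 2 ≤ d) (hq : IsPrimitiveRoot q d) {M N α β n m m' : ℕ}
    (h1 : n < m) (h2 : n < m') (hM : M < m * d + α) (hN : N < m' * d + β) :
    HasGenerators q M N (n * d + (α + β)) ((m + m' - 1 - 2 * n) * d - 1) := by
  refine ⟨?_, ?_⟩
  · rw [← add_assoc]; exact hasGenerator_block hd hq h1 h2 hM hN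
  · rw [add_comm m, add_comm α, ← add_assoc]; exact hasGenerator_block hd hq h2 h1 hN hM

/-- With α = i and β = 0 the bounds e + 1 and m + 1 on the numbers of blocks hold wherever i lies
relative to f and h. -/
theorem hasGenerators_full (hd : 2 ≤ d) (hq : IsPrimitiveRoot q d) (hf : f < d) (hh : h < d)
    {t : ℕ} (i : ℕ) (ht : t ≤ e) (ht' : t ≤ m) :
    HasGenerators q (e * d + f) (m * d + h) (t * d + i) ((e + m - 2 * t) * d + d - 1) := by
  have := hasGenerators_block (M := e * d + f) (N := m * d + h) (α := i) (β := 0) (n := t)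
    (m := e + 1) (m' := m + 1) hd hq (by omega) (by omega) (by rw [add_mul]; omega)
    (by rw [add_mul]; omega)
  rwa [show e + 1 + (m + 1) - 1 - 2 * t = e + m - 2 * t + 1 by omega, add_mul, one_mul] at this

/-- Since i > f, at most e exponents of the form i + da are ≤ ed + f, so the first factor loses a
block. -/
theorem hasGenerators_fst (hd : 2 ≤ d) (hq : IsPrimitiveRoot q d) (hh : h < d)
    {t i : ℕ} (ht : t < e) (ht' : t ≤ m) (hi : f < i) :
    HasGenerators q (e * d + f) (m * d + h) (t * d + i) ((e + m - 2 * t) * d - 1) :=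
  hasGenerators_block (M := e * d + f) (N := m * d + h) (α := i) (β := 0) (n := t)
    (m := e) (m' := m + 1) hd hq (by omega) (by omega) (by omega) (by rw [add_mul]; omega)

theorem hasGenerators_snd (hd : 2 ≤ d) (hq : IsPrimitiveRoot q d) (hf : f < d)
    {t i : ℕ} (ht : t ≤ e) (ht' : t < m) (hi : h < i) :
    HasGenerators q (e * d + f) (m * d + h) (t * d + i) ((e + m - 2 * t) * d - 1) := by
  rw [add_comm e m]
  exact (hasGenerators_fst hd hq hf ht' ht hi).symm

/-- Here i is large enough to be split into α > f and β > h, and both factors lose a block. -/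
theorem hasGenerators_both (hd : 2 ≤ d) (hq : IsPrimitiveRoot q d)
    {t i : ℕ} (ht : t < e) (ht' : t < m) (hi : f + h + 2 ≤ i) :
    HasGenerators q (e * d + f) (m * d + h) (t * d + i) ((e + m - 1 - 2 * t) * d - 1) := by
  obtain ⟨c, rfl⟩ := Nat.exists_eq_add_of_le hi
  have := hasGenerators_block (M := e * d + f) (N := m * d + h) (α := f + 1) (β := h + 1 + c)
    (n := t) (m := e) (m' := m) hd hq ht ht' (by omega) (by omega)
  rwa [show f + 1 + (h + 1 + c) = f + h + 2 + c by omega] at this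

end Both

/-! ### Assembling the summands -/

section Assemble

open FdComodule

variable {k : Type u} [Field k] (q : kˣ) (M N : ℕ)

/-- The comodule `Y` maps onto generators of the degrees in `S`, for both orders of the tensor
factors. -/
def GeneratesBoth (Y : FdComodule k (LinPath q)) (S : Set ℕ) : Prop :=
  (quantumRectangle q M N).Generates Y S ∧ (quantumRectangle q N M).Generates Y S

variable {q M N}

theorem GeneratesBoth.add {Y Z : FdComodule k (LinPath q)} {S S' : Set ℕ}
    (h : GeneratesBoth q M N Y S) (h' : GeneratesBoth q M N Z S') :
    GeneratesBoth q M N (Y ⊕ᶜ Z) (S ∪ S') :=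
  ⟨h.1.add h'.1, h.2.add h'.2⟩

theorem GeneratesBoth.mono {Y : FdComodule k (LinPath q)} {S S' : Set ℕ}
    (h : GeneratesBoth q M N Y S) (hS : ∀ s ∈ S', s ∈ S) : GeneratesBoth q M N Y S' := by
  obtain ⟨⟨φ, hφ, h1⟩, ⟨ψ, hψ, h2⟩⟩ := h
  exact ⟨⟨φ, hφ, fun s hs => h1 s (hS s hs)⟩, ⟨ψ, hψ, fun s hs => h2 s (hS s hs)⟩⟩

theorem GeneratesBoth.sum {Y : ℕ → FdComodule k (LinPath q)} {I : Finset ℕ} {S : ℕ → Set ℕ}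
    (h : ∀ i ∈ I, GeneratesBoth q M N (Y i) (S i)) :
    GeneratesBoth q M N (FdComodule.sum I Y) {s | ∃ i ∈ I, s ∈ S i} :=
  ⟨.sum fun i hi => (h i hi).1, .sum fun i hi => (h i hi).2⟩

theorem generatesBoth_sum_Icc {t d a b : ℕ} {l : ℕ → ℕ}
    (h : ∀ i, a ≤ i → i ≤ b → HasGenerators (q : k) M N (t * d + i) (l i)) :
    GeneratesBoth q M N
      (FdComodule.sum (Finset.Icc a b) fun i => stringComodule q (t * d + i) (l i))
      {s | ∃ i, (a ≤ i ∧ i ≤ b) ∧ s = t * d + i} := by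
  refine (GeneratesBoth.sum (S := fun i => {t * d + i}) fun i hi => ?_).mono ?_
  · obtain ⟨h1, h2⟩ := h i (Finset.mem_Icc.mp hi).1 (Finset.mem_Icc.mp hi).2
    exact ⟨QuantumRectangle.generates_stringComodule (by push_cast; rfl) h1,
      QuantumRectangle.generates_stringComodule (by push_cast; rfl) h2⟩
  · rintro s ⟨i, hi, hs⟩
    exact ⟨i, Finset.mem_Icc.mpr hi, hs⟩

theorem GeneratesBoth.isomorphic {Y : FdComodule k (LinPath q)} {S : Set ℕ}
    (h : GeneratesBoth q M N Y S) (hS : ∀ s, s ≤ M → s ≤ N → s ∈ S)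
    (hr : (Module.finrank k Y.carrier : ℤ) = (M + 1) * (N + 1)) :
    (stringComodule q 0 M ⊗ᶜ stringComodule q 0 N ≅ᶜ Y) ∧
      (stringComodule q 0 N ⊗ᶜ stringComodule q 0 M ≅ᶜ Y) := by
  have hr' : Module.finrank k Y.carrier = (M + 1) * (N + 1) := by exact_mod_cast hr
  refine ⟨(h.1.isomorphic hS ?_).symm, (h.2.isomorphic (fun s h1 h2 => hS s h2 h1) ?_).symm⟩
  · rw [finrank_tensor_stringComodule, hr']
  · rw [finrank_tensor_stringComodule, hr', mul_comm]

/-! ### Dimension counts -/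

theorem finrank_sum_Icc_const {a b c : ℕ} (i : ℕ → ℤ) (hab : a ≤ b + 1) (hc : 1 ≤ c) :
    (Module.finrank k (FdComodule.sum (Finset.Icc a b) fun j =>
      stringComodule q (i j) (c - 1)).carrier : ℤ) = (b + 1 - a) * c := by
  simp only [finrank_sum, finrank_stringComodule, Nat.sub_add_cancel hc, Finset.sum_const,
    Nat.card_Icc, smul_eq_mul, Nat.cast_mul]
  rw [Nat.cast_sub hab]
  push_cast
  ring

/-- An arithmetic progression; `hab` admits the empty range and `hc` keeps c - 2j from truncating.
-/
theorem finrank_sum_Icc_sub {a b c : ℕ} (i : ℕ → ℤ) (hab : a ≤ b + 1) (hc : 2 * b ≤ c) :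
    (Module.finrank k (FdComodule.sum (Finset.Icc a b) fun j =>
      stringComodule q (i j) (c - 2 * j)).carrier : ℤ) = (b + 1 - a) * (c + 1 - a - b) := by
  simp only [finrank_sum, finrank_stringComodule]
  obtain ⟨n, hn⟩ := Nat.exists_eq_add_of_le hab
  have h : ∀ n, a + n ≤ b + 1 → ((∑ j ∈ Finset.Ico a (a + n), (c - 2 * j + 1) : ℕ) : ℤ) =
      n * (c + 1 - a - (a + n - 1)) := by
    intro n
    induction n with
    | zero => simp
    | succ n ih =>
      intro hn
      rw [← add_assoc, Finset.sum_Ico_succ_top (by omega), Nat.cast_add, ih (by omega),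
        Nat.cast_add, Nat.cast_sub (by omega)]
      push_cast
      ring
  rw [show Finset.Icc a b = Finset.Ico a (a + n) by
    ext; simp only [Finset.mem_Icc, Finset.mem_Ico]; omega, h n (by omega)]
  have : (b : ℤ) = a + n - 1 := by omega
  rw [this]
  ring

variable {d e m f h : ℕ}

/-- The dimension of row t is given by the same formula in all four cases, so the sum over t is
evaluated once. -/
theorem finrank_sum_range_rows {row : ℕ → FdComodule k (LinPath q)}
    (hr : ∀ t < e, (Module.finrank k (row t).carrier : ℤ) =
      (e + m - 2 * t) * d ^ 2 - (d - f - h - 2) * d) :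
    (Module.finrank k (FdComodule.sum (Finset.range e) row).carrier : ℤ) =
      e * (m + 1) * d ^ 2 - e * (d - f - h - 2) * d := by
  rw [finrank_sum, Nat.cast_sum, Finset.sum_congr rfl fun t ht => hr t (Finset.mem_range.mp ht)]
  have : ∀ c : ℕ, ∑ t ∈ Finset.range c, (((e : ℤ) + m - 2 * t) * d ^ 2 - (d - f - h - 2) * d) =
      (c : ℤ) * (e + m - c + 1) * d ^ 2 - c * (d - f - h - 2) * d := by
    intro c
    induction c with
    | zero => simp
    | succ c ih => rw [Finset.sum_range_succ, ih]; push_cast; ring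
  rw [this]
  ring

theorem generatesBoth_sum_range_rows {row : ℕ → FdComodule k (LinPath q)}
    (hr : ∀ t < e, GeneratesBoth q M N (row t) {s | ∃ i < d, s = t * d + i}) :
    GeneratesBoth q M N (FdComodule.sum (Finset.range e) row) {s | s < e * d} := by
  refine (GeneratesBoth.sum fun t ht => hr t (Finset.mem_range.mp ht)).mono fun s hs => ?_
  have hd : 0 < d := Nat.pos_of_ne_zero fun h => by simp [h] at hs
  refine ⟨s / d, Finset.mem_range.mpr ((Nat.div_lt_iff_lt_mul hd).mpr hs), s % d,
    Nat.mod_lt _ hd, ?_⟩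
  rw [mul_comm]
  exact (Nat.div_add_mod s d).symm

/-! ### The four cases of the decomposition -/

variable [CharZero k]

/-- Row t supplies generators in the degrees td, ..., td + d - 1: no carry, one block lost in the
first factor, carry, and one block lost in both. The last sum supplies the degrees ed, ..., ed + f.
-/
theorem tensor_decomposition_of_le_of_lt (hd : 2 ≤ d) (hq : IsPrimitiveRoot (q : k) d) (hem : e ≤ m)
    (hfh : f ≤ h) (hlt : f + h < d - 1)
    {Y : FdComodule k (LinPath q)} (hY : Y =
      FdComodule.sum (Finset.range e) (fun t =>
          FdComodule.sum (Finset.Icc 0 f) (fun i =>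
            stringComodule q (t * d + i) ((e + m - 2 * t) * d + f + h - 2 * i)) ⊕ᶜ
          FdComodule.sum (Finset.Icc (f + 1) h) (fun j =>
            stringComodule q (t * d + j) ((e + m - 2 * t) * d - 1)) ⊕ᶜ
          FdComodule.sum (Finset.Icc (h + 1) (f + h + 1)) (fun r =>
            stringComodule q (t * d + r) ((e + m - 2 * t) * d + f + h - 2 * r)) ⊕ᶜ
          FdComodule.sum (Finset.Icc (f + h + 2) (d - 1)) (fun s =>
            stringComodule q (t * d + s) ((e + m - 1 - 2 * t) * d - 1))) ⊕ᶜ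
        FdComodule.sum (Finset.Icc 0 f) (fun i =>
          stringComodule q (e * d + i) ((m - e) * d + f + h - 2 * i))) :
    (stringComodule q 0 (e * d + f) ⊗ᶜ stringComodule q 0 (m * d + h) ≅ᶜ Y) ∧
      (stringComodule q 0 (m * d + h) ⊗ᶜ stringComodule q 0 (e * d + f) ≅ᶜ Y) := by
  subst hY
  have hme : m - e = e + m - 2 * e := by omega
  refine GeneratesBoth.isomorphic ((generatesBoth_sum_range_rows (d := d) fun t ht =>
    ((((generatesBoth_sum_Icc fun i hi hi' => hasGenerators_low hd hq (by omega) (by omega) (by omega)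
      (by omega) (by omega)).add
    (generatesBoth_sum_Icc fun i hi hi' => hasGenerators_fst hd hq (by omega) (by omega) (by omega)
      (by omega))).add
    (generatesBoth_sum_Icc fun i hi hi' => hasGenerators_high hd hq (by omega) (by omega) (by omega)
      (by omega) (by omega) (by omega))).add
    (generatesBoth_sum_Icc fun i hi hi' => hasGenerators_both hd hq (by omega) (by omega) hi)).mono ?_).add
    (generatesBoth_sum_Icc fun i hi hi' => hme ▸ hasGenerators_low hd hq (by omega) (by omega) (by omega)
      (by omega) (by omega))) ?_ ?_
  · rintro s ⟨i, hi, rfl⟩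
    simp only [Set.mem_union, Set.mem_ofPred_eq, Nat.add_left_cancel_iff, exists_eq_right']
    omega
  · intro s hs hs'
    rcases Nat.lt_or_ge s (e * d) with h1 | h1
    · simp [h1]
    · obtain ⟨i, rfl⟩ := Nat.exists_eq_add_of_le h1
      simp only [Set.mem_union, Set.mem_ofPred_eq, Nat.add_left_cancel_iff, exists_eq_right']
      omega
  · rw [finrank_add, Nat.cast_add, 
      finrank_sum_range_rows (m := m) (f := f) (h := h) (d := d),
      finrank_sum_Icc_sub _ (by omega) (by omega)]
    · push_cast [hem]; ring
    · intro t ht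
      obtain ⟨x, rfl⟩ := Nat.exists_eq_add_of_lt ht
      obtain ⟨y, rfl⟩ := Nat.exists_eq_add_of_le hem
      -- D stands for e + m - 1 - 2t, which is at least 1 because t < e. Then d ≤ D * d keeps the
      -- lengths in the row from truncating.
      obtain ⟨D, hD⟩ : ∃ D, D = 2 * x + y + 1 := ⟨_, rfl⟩
      have hD1 : t + x + 1 + (t + x + 1 + y) - 2 * t = D + 1 := by omega
      have hD2 : t + x + 1 + (t + x + 1 + y) - 1 - 2 * t = D := by omega
      have hDd : d ≤ D * d := Nat.le_mul_of_pos_left d (by omega)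
      rw [finrank_add, finrank_add, finrank_add, Nat.cast_add, Nat.cast_add, Nat.cast_add,
        finrank_sum_Icc_sub _ (by omega) (by rw [hD1, add_mul]; omega),
        finrank_sum_Icc_const _ (by omega) (by rw [hD1, add_mul]; omega),
        finrank_sum_Icc_sub _ (by omega) (by rw [hD1, add_mul]; omega),
        finrank_sum_Icc_const _ (by omega) (by rw [hD2]; omega)]
      simp only [hD1, hD2]
      push_cast [show 1 ≤ d by omega, hD]
      ring

/-- For i ≤ γ the digits in `hasGenerators_low` would carry, and full blocks take their place. No i
< d reaches f + h + 2, so both factors never lose a block together. -/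
theorem tensor_decomposition_of_le_of_ge (hd : 2 ≤ d) (hq : IsPrimitiveRoot (q : k) d) (hem : e ≤ m)
    (hh : h < d) (hfh : f ≤ h) (hge : d - 1 ≤ f + h)
    {Y : FdComodule k (LinPath q)} (hY : Y =
      FdComodule.sum (Finset.range e) (fun t =>
          FdComodule.sum (Finset.Icc 0 (f + h + 1 - d)) (fun i =>
            stringComodule q (t * d + i) ((e + m - 2 * t) * d + d - 1)) ⊕ᶜ
          FdComodule.sum (Finset.Icc (f + h + 1 - d + 1) f) (fun j =>
            stringComodule q (t * d + j) ((e + m - 2 * t) * d + f + h - 2 * j)) ⊕ᶜ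
          FdComodule.sum (Finset.Icc (f + 1) h) (fun r =>
            stringComodule q (t * d + r) ((e + m - 2 * t) * d - 1)) ⊕ᶜ
          FdComodule.sum (Finset.Icc (h + 1) (d - 1)) (fun s =>
            stringComodule q (t * d + s) ((e + m - 2 * t) * d + f + h - 2 * s))) ⊕ᶜ
        FdComodule.sum (Finset.Icc 0 (f + h + 1 - d)) (fun i =>
          stringComodule q (e * d + i) ((m - e) * d + d - 1)) ⊕ᶜ
        FdComodule.sum (Finset.Icc (f + h + 1 - d + 1) f) (fun i =>
          stringComodule q (e * d + i) ((m - e) * d + f + h - 2 * i))) :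
    (stringComodule q 0 (e * d + f) ⊗ᶜ stringComodule q 0 (m * d + h) ≅ᶜ Y) ∧
      (stringComodule q 0 (m * d + h) ⊗ᶜ stringComodule q 0 (e * d + f) ≅ᶜ Y) := by
  subst hY
  have hme : m - e = e + m - 2 * e := by omega
  refine GeneratesBoth.isomorphic (((generatesBoth_sum_range_rows (d := d) fun t ht =>
    ((((generatesBoth_sum_Icc fun i hi hi' => hasGenerators_full hd hq (by omega) (by omega) i (by omega)
      (by omega)).add
    (generatesBoth_sum_Icc fun i hi hi' => hasGenerators_low hd hq (by omega) (by omega) (by omega)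
      (by omega) (by omega))).add
    (generatesBoth_sum_Icc fun i hi hi' => hasGenerators_fst hd hq (by omega) (by omega) (by omega)
      (by omega))).add
    (generatesBoth_sum_Icc fun i hi hi' => hasGenerators_high hd hq (by omega) (by omega) (by omega)
      (by omega) (by omega) (by omega))).mono ?_).add
    (generatesBoth_sum_Icc fun i hi hi' => hme ▸ hasGenerators_full hd hq (by omega) (by omega) i (by omega)
      (by omega))).add
    (generatesBoth_sum_Icc fun i hi hi' => hme ▸ hasGenerators_low hd hq (by omega) (by omega) (by omega)
      (by omega) (by omega))) ?_ ?_
  · rintro s ⟨i, hi, rfl⟩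
    simp only [Set.mem_union, Set.mem_ofPred_eq, Nat.add_left_cancel_iff, exists_eq_right']
    omega
  · intro s hs hs'
    rcases Nat.lt_or_ge s (e * d) with h1 | h1
    · simp [h1]
    · obtain ⟨i, rfl⟩ := Nat.exists_eq_add_of_le h1
      simp only [Set.mem_union, Set.mem_ofPred_eq, Nat.add_left_cancel_iff, exists_eq_right']
      omega
  · rw [finrank_add, finrank_add, Nat.cast_add, Nat.cast_add, 
      finrank_sum_range_rows (m := m) (f := f) (h := h) (d := d),
      finrank_sum_Icc_const _ (by omega) (by omega),
      finrank_sum_Icc_sub _ (by omega) (by omega)]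
    · push_cast [hem, show d ≤ f + h + 1 by omega]; ring
    · intro t ht
      obtain ⟨x, rfl⟩ := Nat.exists_eq_add_of_lt ht
      obtain ⟨y, rfl⟩ := Nat.exists_eq_add_of_le hem
      obtain ⟨D, hD⟩ : ∃ D, D = 2 * x + y + 1 := ⟨_, rfl⟩
      have hD1 : t + x + 1 + (t + x + 1 + y) - 2 * t = D + 1 := by omega
      have hDd : d ≤ D * d := Nat.le_mul_of_pos_left d (by omega)
      rw [finrank_add, finrank_add, finrank_add, Nat.cast_add, Nat.cast_add, Nat.cast_add,
        finrank_sum_Icc_const _ (by omega) (by rw [hD1, add_mul]; omega),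
        finrank_sum_Icc_sub _ (by omega) (by rw [hD1, add_mul]; omega),
        finrank_sum_Icc_const _ (by omega) (by rw [hD1, add_mul]; omega),
        finrank_sum_Icc_sub _ (by omega) (by rw [hD1, add_mul]; omega)]
      rw [hD1]
      push_cast [show 1 ≤ d by omega, hD, show d ≤ f + h + 1 by omega]
      ring

/-- Now the second factor is the one that loses a block. The last row has the extra range h < i ≤ f,
where `hasGenerators_snd` with t = e needs e < m; this also makes (m - e) * d - 1 a true
subtraction. -/
theorem tensor_decomposition_of_lt_of_lt (hd : 2 ≤ d) (hq : IsPrimitiveRoot (q : k) d) (hem : e ≤ m)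
    (hem' : e < m) (hhf : h < f) (hlt : f + h < d - 1)
    {Y : FdComodule k (LinPath q)} (hY : Y =
      FdComodule.sum (Finset.range e) (fun t =>
          FdComodule.sum (Finset.Icc 0 h) (fun i =>
            stringComodule q (t * d + i) ((e + m - 2 * t) * d + f + h - 2 * i)) ⊕ᶜ
          FdComodule.sum (Finset.Icc (h + 1) f) (fun j =>
            stringComodule q (t * d + j) ((e + m - 2 * t) * d - 1)) ⊕ᶜ
          FdComodule.sum (Finset.Icc (f + 1) (f + h + 1)) (fun r =>
            stringComodule q (t * d + r) ((e + m - 2 * t) * d + f + h - 2 * r)) ⊕ᶜ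
          FdComodule.sum (Finset.Icc (f + h + 2) (d - 1)) (fun s =>
            stringComodule q (t * d + s) ((e + m - 1 - 2 * t) * d - 1))) ⊕ᶜ
        FdComodule.sum (Finset.Icc 0 h) (fun i =>
          stringComodule q (e * d + i) ((m - e) * d + f + h - 2 * i)) ⊕ᶜ
        FdComodule.sum (Finset.Icc (h + 1) f) (fun i =>
          stringComodule q (e * d + i) ((m - e) * d - 1))) :
    (stringComodule q 0 (e * d + f) ⊗ᶜ stringComodule q 0 (m * d + h) ≅ᶜ Y) ∧
      (stringComodule q 0 (m * d + h) ⊗ᶜ stringComodule q 0 (e * d + f) ≅ᶜ Y) := by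
  subst hY
  have hme : m - e = e + m - 2 * e := by omega
  refine GeneratesBoth.isomorphic (((generatesBoth_sum_range_rows (d := d) fun t ht =>
    ((((generatesBoth_sum_Icc fun i hi hi' => hasGenerators_low hd hq (by omega) (by omega) (by omega)
      (by omega) (by omega)).add
    (generatesBoth_sum_Icc fun i hi hi' => hasGenerators_snd hd hq (by omega) (by omega) (by omega)
      (by omega))).add
    (generatesBoth_sum_Icc fun i hi hi' => hasGenerators_high hd hq (by omega) (by omega) (by omega)
      (by omega) (by omega) (by omega))).add
    (generatesBoth_sum_Icc fun i hi hi' => hasGenerators_both hd hq (by omega) (by omega) hi)).mono ?_).add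
    (generatesBoth_sum_Icc fun i hi hi' => hme ▸ hasGenerators_low hd hq (by omega) (by omega) (by omega)
      (by omega) (by omega))).add
    (generatesBoth_sum_Icc fun i hi hi' => hme ▸ hasGenerators_snd hd hq (by omega) (by omega) (by omega)
      (by omega))) ?_ ?_
  · rintro s ⟨i, hi, rfl⟩
    simp only [Set.mem_union, Set.mem_ofPred_eq, Nat.add_left_cancel_iff, exists_eq_right']
    omega
  · intro s hs hs'
    rcases Nat.lt_or_ge s (e * d) with h1 | h1
    · simp [h1]
    · obtain ⟨i, rfl⟩ := Nat.exists_eq_add_of_le h1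
      simp only [Set.mem_union, Set.mem_ofPred_eq, Nat.add_left_cancel_iff, exists_eq_right']
      omega
  · rw [finrank_add, finrank_add, Nat.cast_add, Nat.cast_add, 
      finrank_sum_range_rows (m := m) (f := f) (h := h) (d := d),
      finrank_sum_Icc_sub _ (by omega) (by omega),
      finrank_sum_Icc_const _ (by omega) (Nat.mul_pos (by omega) (by omega))]
    · push_cast [hem]; ring
    · intro t ht
      obtain ⟨x, rfl⟩ := Nat.exists_eq_add_of_lt ht
      obtain ⟨y, rfl⟩ := Nat.exists_eq_add_of_le hem
      obtain ⟨D, hD⟩ : ∃ D, D = 2 * x + y + 1 := ⟨_, rfl⟩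
      have hD1 : t + x + 1 + (t + x + 1 + y) - 2 * t = D + 1 := by omega
      have hD2 : t + x + 1 + (t + x + 1 + y) - 1 - 2 * t = D := by omega
      have hDd : d ≤ D * d := Nat.le_mul_of_pos_left d (by omega)
      rw [finrank_add, finrank_add, finrank_add, Nat.cast_add, Nat.cast_add, Nat.cast_add,
        finrank_sum_Icc_sub _ (by omega) (by rw [hD1, add_mul]; omega),
        finrank_sum_Icc_const _ (by omega) (by rw [hD1, add_mul]; omega),
        finrank_sum_Icc_sub _ (by omega) (by rw [hD1, add_mul]; omega),
        finrank_sum_Icc_const _ (by omega) (by rw [hD2]; omega)]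
      simp only [hD1, hD2]
      push_cast [show 1 ≤ d by omega, hD]
      ring

theorem tensor_decomposition_of_lt_of_ge (hd : 2 ≤ d) (hq : IsPrimitiveRoot (q : k) d) (hem : e ≤ m)
    (hem' : e < m) (hf : f < d) (hhf : h < f) (hge : d - 1 ≤ f + h)
    {Y : FdComodule k (LinPath q)} (hY : Y =
      FdComodule.sum (Finset.range e) (fun t =>
          FdComodule.sum (Finset.Icc 0 (f + h + 1 - d)) (fun i =>
            stringComodule q (t * d + i) ((e + m - 2 * t) * d + d - 1)) ⊕ᶜ
          FdComodule.sum (Finset.Icc (f + h + 1 - d + 1) h) (fun j =>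
            stringComodule q (t * d + j) ((e + m - 2 * t) * d + f + h - 2 * j)) ⊕ᶜ
          FdComodule.sum (Finset.Icc (h + 1) f) (fun r =>
            stringComodule q (t * d + r) ((e + m - 2 * t) * d - 1)) ⊕ᶜ
          FdComodule.sum (Finset.Icc (f + 1) (d - 1)) (fun s =>
            stringComodule q (t * d + s) ((e + m - 2 * t) * d + f + h - 2 * s))) ⊕ᶜ
        FdComodule.sum (Finset.Icc 0 (f + h + 1 - d)) (fun i =>
          stringComodule q (e * d + i) ((m - e) * d + d - 1)) ⊕ᶜ
        FdComodule.sum (Finset.Icc (f + h + 1 - d + 1) h) (fun i =>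
          stringComodule q (e * d + i) ((m - e) * d + f + h - 2 * i)) ⊕ᶜ
        FdComodule.sum (Finset.Icc (h + 1) f) (fun i =>
          stringComodule q (e * d + i) ((m - e) * d - 1))) :
    (stringComodule q 0 (e * d + f) ⊗ᶜ stringComodule q 0 (m * d + h) ≅ᶜ Y) ∧
      (stringComodule q 0 (m * d + h) ⊗ᶜ stringComodule q 0 (e * d + f) ≅ᶜ Y) := by
  subst hY
  have hme : m - e = e + m - 2 * e := by omega
  refine GeneratesBoth.isomorphic ((((generatesBoth_sum_range_rows (d := d) fun t ht =>
    ((((generatesBoth_sum_Icc fun i hi hi' => hasGenerators_full hd hq (by omega) (by omega) i (by omega)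
      (by omega)).add
    (generatesBoth_sum_Icc fun i hi hi' => hasGenerators_low hd hq (by omega) (by omega) (by omega)
      (by omega) (by omega))).add
    (generatesBoth_sum_Icc fun i hi hi' => hasGenerators_snd hd hq (by omega) (by omega) (by omega)
      (by omega))).add
    (generatesBoth_sum_Icc fun i hi hi' => hasGenerators_high hd hq (by omega) (by omega) (by omega)
      (by omega) (by omega) (by omega))).mono ?_).add
    (generatesBoth_sum_Icc fun i hi hi' => hme ▸ hasGenerators_full hd hq (by omega) (by omega) i (by omega)
      (by omega))).add
    (generatesBoth_sum_Icc fun i hi hi' => hme ▸ hasGenerators_low hd hq (by omega) (by omega) (by omega)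
      (by omega) (by omega))).add
    (generatesBoth_sum_Icc fun i hi hi' => hme ▸ hasGenerators_snd hd hq (by omega) (by omega) (by omega)
      (by omega))) ?_ ?_
  · rintro s ⟨i, hi, rfl⟩
    simp only [Set.mem_union, Set.mem_ofPred_eq, Nat.add_left_cancel_iff, exists_eq_right']
    omega
  · intro s hs hs'
    rcases Nat.lt_or_ge s (e * d) with h1 | h1
    · simp [h1]
    · obtain ⟨i, rfl⟩ := Nat.exists_eq_add_of_le h1
      simp only [Set.mem_union, Set.mem_ofPred_eq, Nat.add_left_cancel_iff, exists_eq_right']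
      omega
  · rw [finrank_add, finrank_add, finrank_add, Nat.cast_add, Nat.cast_add, Nat.cast_add, 
      finrank_sum_range_rows (m := m) (f := f) (h := h) (d := d),
      finrank_sum_Icc_const _ (by omega) (by omega),
      finrank_sum_Icc_sub _ (by omega) (by omega),
      finrank_sum_Icc_const _ (by omega) (Nat.mul_pos (by omega) (by omega))]
    · push_cast [hem, show d ≤ f + h + 1 by omega]; ring
    · intro t ht
      obtain ⟨x, rfl⟩ := Nat.exists_eq_add_of_lt ht
      obtain ⟨y, rfl⟩ := Nat.exists_eq_add_of_le hem
      obtain ⟨D, hD⟩ : ∃ D, D = 2 * x + y + 1 := ⟨_, rfl⟩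
      have hD1 : t + x + 1 + (t + x + 1 + y) - 2 * t = D + 1 := by omega
      have hDd : d ≤ D * d := Nat.le_mul_of_pos_left d (by omega)
      rw [finrank_add, finrank_add, finrank_add, Nat.cast_add, Nat.cast_add, Nat.cast_add,
        finrank_sum_Icc_const _ (by omega) (by rw [hD1, add_mul]; omega),
        finrank_sum_Icc_sub _ (by omega) (by rw [hD1, add_mul]; omega),
        finrank_sum_Icc_const _ (by omega) (by rw [hD1, add_mul]; omega),
        finrank_sum_Icc_sub _ (by omega) (by rw [hD1, add_mul]; omega)]
      rw [hD1]
      push_cast [show 1 ≤ d by omega, hD, show d ≤ f + h + 1 by omega]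
      ring

end Assemble

end

/-- The Clebsch-Gordan formulae for the finite dimensional right comodules over the bialgebra
`LinPath q` of the infinite linear quiver, for `q` a root of unity of order `d ≥ 2`. In all four
cases the lengths are natural numbers by `e * d + f ≤ m * d + h` (no subtraction truncates), and
`f + h + 1 - d` is the number `γ`. -/
theorem theorem4p12 {k : Type*} [Field k] [IsAlgClosed k] [CharZero k]
    (q : kˣ) (d : ℕ) (hd : 2 ≤ d) (hq : IsPrimitiveRoot q d)
    (e m f h : ℕ) (hf : f < d) (hh : h < d) (hle : e * d + f ≤ m * d + h) :
    (stringComodule q 0 (e * d + f) ⊗ᶜ stringComodule q 0 (m * d + h) ≅ᶜ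
      stringComodule q 0 (m * d + h) ⊗ᶜ stringComodule q 0 (e * d + f)) ∧
    (f ≤ h → f + h < d - 1 →
      stringComodule q 0 (e * d + f) ⊗ᶜ stringComodule q 0 (m * d + h) ≅ᶜ
        FdComodule.sum (Finset.range e) (fun t =>
          FdComodule.sum (Finset.Icc 0 f) (fun i =>
            stringComodule q (t * d + i) ((e + m - 2 * t) * d + f + h - 2 * i)) ⊕ᶜ
          FdComodule.sum (Finset.Icc (f + 1) h) (fun j =>
            stringComodule q (t * d + j) ((e + m - 2 * t) * d - 1)) ⊕ᶜ
          FdComodule.sum (Finset.Icc (h + 1) (f + h + 1)) (fun r =>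
            stringComodule q (t * d + r) ((e + m - 2 * t) * d + f + h - 2 * r)) ⊕ᶜ
          FdComodule.sum (Finset.Icc (f + h + 2) (d - 1)) (fun s =>
            stringComodule q (t * d + s) ((e + m - 1 - 2 * t) * d - 1))) ⊕ᶜ
        FdComodule.sum (Finset.Icc 0 f) (fun i =>
          stringComodule q (e * d + i) ((m - e) * d + f + h - 2 * i))) ∧
    (f ≤ h → d - 1 ≤ f + h →
      stringComodule q 0 (e * d + f) ⊗ᶜ stringComodule q 0 (m * d + h) ≅ᶜ
        FdComodule.sum (Finset.range e) (fun t =>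
          FdComodule.sum (Finset.Icc 0 (f + h + 1 - d)) (fun i =>
            stringComodule q (t * d + i) ((e + m - 2 * t) * d + d - 1)) ⊕ᶜ
          FdComodule.sum (Finset.Icc (f + h + 1 - d + 1) f) (fun j =>
            stringComodule q (t * d + j) ((e + m - 2 * t) * d + f + h - 2 * j)) ⊕ᶜ
          FdComodule.sum (Finset.Icc (f + 1) h) (fun r =>
            stringComodule q (t * d + r) ((e + m - 2 * t) * d - 1)) ⊕ᶜ
          FdComodule.sum (Finset.Icc (h + 1) (d - 1)) (fun s =>
            stringComodule q (t * d + s) ((e + m - 2 * t) * d + f + h - 2 * s))) ⊕ᶜ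
        FdComodule.sum (Finset.Icc 0 (f + h + 1 - d)) (fun i =>
          stringComodule q (e * d + i) ((m - e) * d + d - 1)) ⊕ᶜ
        FdComodule.sum (Finset.Icc (f + h + 1 - d + 1) f) (fun i =>
          stringComodule q (e * d + i) ((m - e) * d + f + h - 2 * i))) ∧
    (h < f → f + h < d - 1 →
      stringComodule q 0 (e * d + f) ⊗ᶜ stringComodule q 0 (m * d + h) ≅ᶜ
        FdComodule.sum (Finset.range e) (fun t =>
          FdComodule.sum (Finset.Icc 0 h) (fun i =>
            stringComodule q (t * d + i) ((e + m - 2 * t) * d + f + h - 2 * i)) ⊕ᶜ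
          FdComodule.sum (Finset.Icc (h + 1) f) (fun j =>
            stringComodule q (t * d + j) ((e + m - 2 * t) * d - 1)) ⊕ᶜ
          FdComodule.sum (Finset.Icc (f + 1) (f + h + 1)) (fun r =>
            stringComodule q (t * d + r) ((e + m - 2 * t) * d + f + h - 2 * r)) ⊕ᶜ
          FdComodule.sum (Finset.Icc (f + h + 2) (d - 1)) (fun s =>
            stringComodule q (t * d + s) ((e + m - 1 - 2 * t) * d - 1))) ⊕ᶜ
        FdComodule.sum (Finset.Icc 0 h) (fun i =>
          stringComodule q (e * d + i) ((m - e) * d + f + h - 2 * i)) ⊕ᶜ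
        FdComodule.sum (Finset.Icc (h + 1) f) (fun i =>
          stringComodule q (e * d + i) ((m - e) * d - 1))) ∧
    (h < f → d - 1 ≤ f + h →
      stringComodule q 0 (e * d + f) ⊗ᶜ stringComodule q 0 (m * d + h) ≅ᶜ
        FdComodule.sum (Finset.range e) (fun t =>
          FdComodule.sum (Finset.Icc 0 (f + h + 1 - d)) (fun i =>
            stringComodule q (t * d + i) ((e + m - 2 * t) * d + d - 1)) ⊕ᶜ
          FdComodule.sum (Finset.Icc (f + h + 1 - d + 1) h) (fun j =>
            stringComodule q (t * d + j) ((e + m - 2 * t) * d + f + h - 2 * j)) ⊕ᶜ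
          FdComodule.sum (Finset.Icc (h + 1) f) (fun r =>
            stringComodule q (t * d + r) ((e + m - 2 * t) * d - 1)) ⊕ᶜ
          FdComodule.sum (Finset.Icc (f + 1) (d - 1)) (fun s =>
            stringComodule q (t * d + s) ((e + m - 2 * t) * d + f + h - 2 * s))) ⊕ᶜ
        FdComodule.sum (Finset.Icc 0 (f + h + 1 - d)) (fun i =>
          stringComodule q (e * d + i) ((m - e) * d + d - 1)) ⊕ᶜ
        FdComodule.sum (Finset.Icc (f + h + 1 - d + 1) h) (fun i =>
          stringComodule q (e * d + i) ((m - e) * d + f + h - 2 * i)) ⊕ᶜ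
        FdComodule.sum (Finset.Icc (h + 1) f) (fun i =>
          stringComodule q (e * d + i) ((m - e) * d - 1))) := by 
  have hq' : IsPrimitiveRoot (q : k) d := IsPrimitiveRoot.coe_units_iff.mpr hq
  have hem : e ≤ m := by
    by_contra hc
    have := Nat.mul_le_mul_right d (show m + 1 ≤ e by omega)
    rw [add_mul] at this
    omega
  -- For e = m the assumption on the sizes would give f ≤ h.
  have hem' : h < f → e < m := fun hhf => by
    refine lt_of_le_of_ne hem ?_
    rintro rfl
    omega
  refine ⟨?_,
    fun h1 h2 => (tensor_decomposition_of_le_of_lt hd hq' hem h1 h2 rfl).1,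
    fun h1 h2 => (tensor_decomposition_of_le_of_ge hd hq' hem hh h1 h2 rfl).1,
    fun h1 h2 => (tensor_decomposition_of_lt_of_lt hd hq' hem (hem' h1) h1 h2 rfl).1,
    fun h1 h2 => (tensor_decomposition_of_lt_of_ge hd hq' hem (hem' h1) hf h1 h2 rfl).1⟩
  -- In each case both orders of the factors are isomorphic to the same explicit sum.
  rcases Nat.lt_or_ge h f with h1 | h1 <;> rcases Nat.lt_or_ge (f + h) (d - 1) with h2 | h2
  · obtain ⟨i, j⟩ := tensor_decomposition_of_lt_of_lt hd hq' hem (hem' h1) h1 h2 rfl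
    exact i.trans j.symm
  · obtain ⟨i, j⟩ := tensor_decomposition_of_lt_of_ge hd hq' hem (hem' h1) hf h1 h2 rfl
    exact i.trans j.symm
  · obtain ⟨i, j⟩ := tensor_decomposition_of_le_of_lt hd hq' hem h1 h2 rfl
    exact i.trans j.symm
  · obtain ⟨i, j⟩ := tensor_decomposition_of_le_of_ge hd hq' hem hh h1 h2 rfl
    exact i.trans j.symm
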